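/- Let $\delta\ge 1$ be an integer, $\tau\in\mathbb C$ with $\tau_2=\operatorname{Im}\tau>0$, $\Lambda=\mathbb Z\lambda_1+\mathbb Z\lambda_2\subset\mathbb C$ with $\lambda_1=\delta$, $\lambda_2=\tau$, and $M=\mathbb C/\Lambda$. Let $L_0\to M$ be the holomorphic line bundle with multipliers $e_{\lambda_1}(z)=1$, $e_{\lambda_2}(z)=e^{-2\pi i z-\pi i\tau}$ (so $\deg L_0=\delta$), and let $T_\mu$ be translation of $M$ by $\mu$. Let $\hat M=\mathrm{Pic}^0(M)$, written as $\mathbb C/(\mathbb Z+\mathbb Z\frac{\tau}{\delta})$ in the coordinate $\hat\mu$ for which $\hat\mu$ corresponds to the class of $\frac{-i\hat\mu}{2\tau_2}\,d\bar z$ in $H^{0,1}(M)$; then $\varphi\colon M\to\hat M$, $\varphi([\mu])=T_\mu^*L_0\otimes L_0^*$, is induced by $\mu\mapsto\hat\mu=\mu$. Let $P\to M\times\hat M$ be the Poincaré line bundle: $P|_{M\times\{\hat\mu\}}$ is the line bundle with parameter $\hat\mu$, and $P|_{\{0\}\times\hat M}$ is trivial. Explicitly, at the lattice element $(a\delta+b\tau,\;c+d\frac{\tau}{\delta})$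 its multiplier is $\exp\bigl(-2\pi i(b\hat\mu+\tfrac{d}{\delta}z+\tfrac{bd}{\delta}\tau)\bigr)$. Put $$\tilde K=\pi_1^*L_0\otimes(\mathrm{Id}\times\varphi)^*P\otimes\pi_2^*L_0\to M\times M ,\qquad K=(\pi_2)_*\tilde K\to M .$$ The fibre of $K$ at $\mu$ is $K|_\mu=H^0(M,\tilde K|_{M\times\{\mu\}})$, and the sections of $K$ over an open set $W\subseteq M$ are the holomorphic sections of $\tilde K$ over $M\times W$. In terms of multipliers, sections are quasi-periodic holomorphic functions of $(z,\mu)$. The function $h(z,\mu)=e^{-\frac{2\pi}{\tau_2}(\operatorname{Im}z+\operatorname{Im}\mu)^2}$ is a Hermitian metric on $\tilde K$, and it defines the $L^2$-metric $$(s,t)_h(\mu)=\int_M h(z,\mu)\,s(z)\,\overline{t(z)}\;\tfrac i2\,dz\wedge d\bar z ,\qquad s,t\in K|_\mu .$$ For $m=0,\dots,\delta-1$ let $$\theta_m(z,\mu)=\sum_{k\in\mathbb Z}e^{\pi i k^2\tau}\,e^{2\pi i\tau\frac m\delta k}\,e^{2\pi i\frac{k\delta+m}{\delta}(z+\mu)}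 .$$ **Theorem.** (1) $(\cdot,\cdot)_h$ is a smooth Hermitian metric on $K$ whose curvature is identically zero: for every open $W\subseteq M$ and every holomorphic frame $(s_i)$ of $K$ over $W$ (sections over $W$ whose values form a basis of every fibre over $W$), the Gram matrix $H=((s_i,s_j)_h)_{i,j}$ is smooth and positive definite on $W$, and $\bar\partial(\partial H\cdot H^{-1})=0$. (2) $K$ splits holomorphically as $K=\bigoplus_{m=0}^{\delta-1}K_m$, where each $K_m$ is a holomorphically trivial line bundle with canonical section $\theta_m$. That is: each $\theta_m$ is a global holomorphic section of $K$; for every $\mu$, $K|_\mu$ is the direct sum of the lines $K_m|_\mu=\mathbb C\,\theta_m(\cdot,\mu)$, each of dimension one; for every open $W\subseteq M$, the space of sections of $K$ over $W$ is the direct sum of the spaces of sections of the $K_m$ over $W$ (the sections of $K$ with values in $K_m$); and $f\mapsto f\theta_m$ is a bijection from the holomorphic functions on $W$ to the sections of $K_m$ over $W$. -/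

import Mathlib

open scoped ContDiff ComplexOrder

noncomputable section

namespace ThetaBundle

/-! ### Complex tori, holomorphic line bundles and Hermitian metrics -/

section General

variable {G G' V V' : Type*} [AddCommGroup G] [AddCommGroup G']
  [NormedAddCommGroup V] [NormedSpace ℂ V] [NormedAddCommGroup V'] [NormedSpace ℂ V']

/-- The torus `V / Λ`, where the lattice `Λ` is the range of the period map `p`
(for `G = ℤ × ℤ` and `V = ℂ` the period map is `(a, b) ↦ a λ₁ + b λ₂`). -/
abbrev Torus (p : G →+ V) : Type _ := V ⧸ p.range

/-- The preimage in `V` of a subset of the torus `V / Λ`. -/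
def cover (p : G →+ V) (U : Set (Torus p)) : Set V := {v | (v : Torus p) ∈ U}

/-- A holomorphic line bundle on `V / Λ`, given by a system of multipliers
`e_g ∈ 𝒪*(V)`: the bundle is the quotient of `V × ℂ` by `g · (v, c) = (v + p g, e_g(v) c)`. -/
structure LineBundle (p : G →+ V) where
  mult : G → V → ℂ
  holo : ∀ g, Differentiable ℂ (mult g)
  ne_zero : ∀ g v, mult g v ≠ 0
  cocycle : ∀ g g' v, mult (g + g') v = mult g' (v + p g) * mult g v

namespace LineBundle

variable {p : G →+ V} {q : G' →+ V'}

/-- The trivial line bundle. -/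
def trivial (p : G →+ V) : LineBundle p where
  mult _ _ := 1
  holo _ := differentiable_const _
  ne_zero _ _ := one_ne_zero
  cocycle _ _ _ := (mul_one 1).symm

/-- The tensor product of two line bundles. -/
def tensor (L N : LineBundle p) : LineBundle p where
  mult g v := L.mult g v * N.mult g v
  holo g := (L.holo g).mul (N.holo g)
  ne_zero g v := mul_ne_zero (L.ne_zero g v) (N.ne_zero g v)
  cocycle g g' v := by rw [L.cocycle, N.cocycle]; ring

/-- The dual of a line bundle. -/
def dual (L : LineBundle p) : LineBundle p where
  mult g v := (L.mult g v)⁻¹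
  holo g := (L.holo g).inv (L.ne_zero g)
  ne_zero g v := inv_ne_zero (L.ne_zero g v)
  cocycle g g' v := by rw [L.cocycle, mul_inv]

/-- The pull-back of a line bundle along the holomorphic map of tori that is induced by
a holomorphic map `F` which is equivariant for a homomorphism `ρ` of period groups. -/
def pullback (L : LineBundle q) (F : V → V') (hF : Differentiable ℂ F) (ρ : G →+ G')
    (h : ∀ g v, F (v + p g) = F v + q (ρ g)) : LineBundle p where
  mult g v := L.mult (ρ g) (F v)
  holo g := (L.holo (ρ g)).comp hF
  ne_zero g v := L.ne_zero _ _
  cocycle g g' v := by rw [map_add, L.cocycle, h]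

/-- Two line bundles are holomorphically isomorphic: multiplication by a nowhere vanishing
entire function carries the multipliers of `L` to those of `N`. -/
def Isomorphic (L N : LineBundle p) : Prop :=
  ∃ f : V → ℂ, Differentiable ℂ f ∧ (∀ v, f v ≠ 0) ∧
    ∀ g v, f (v + p g) * L.mult g v = N.mult g v * f v

/-- The holomorphic sections of `L` over `U ⊆ V / Λ`: holomorphic functions on the preimage
of `U` with the automorphy property (as functions on `V`, they are extended by zero
outside that preimage). -/
def sections (L : LineBundle p) (U : Set (Torus p)) : Submodule ℂ (V → ℂ) where
  carrier := {s | DifferentiableOn ℂ s (cover p U) ∧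
    (∀ g, ∀ v ∈ cover p U, s (v + p g) = L.mult g v * s v) ∧ ∀ v, v ∉ cover p U → s v = 0}
  zero_mem' := ⟨differentiableOn_const _, by simp, by simp⟩
  add_mem' := by
    rintro s t ⟨hs, hs', hs''⟩ ⟨ht, ht', ht''⟩
    refine ⟨hs.add ht, fun g v hv => ?_, fun v hv => ?_⟩
    · simp only [Pi.add_apply, hs' g v hv, ht' g v hv]; ring
    · simp only [Pi.add_apply, hs'' v hv, ht'' v hv, add_zero]
  smul_mem' := by
    rintro c s ⟨hs, hs', hs''⟩
    refine ⟨hs.const_smul c, fun g v hv => ?_, fun v hv => ?_⟩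
    · simp only [Pi.smul_apply, hs' g v hv, smul_eq_mul]; ring
    · simp only [Pi.smul_apply, hs'' v hv, smul_zero]

/-- The space `H⁰` of global holomorphic sections. -/
def H0 (L : LineBundle p) : Submodule ℂ (V → ℂ) := L.sections Set.univ

/-- A smooth Hermitian metric on `L`: the section with local function `s` has squared
length `h |s|²`, so that `h |s|²` is a function on the torus. -/
structure HermitianMetric (L : LineBundle p) where
  h : V → ℝ
  smooth : ContDiff ℝ ∞ h
  pos : ∀ v, 0 < h v
  invariant : ∀ g v, h (v + p g) * ‖L.mult g v‖ ^ 2 = h v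

end LineBundle

/-- The holomorphic functions on `W ⊆ V / Λ`. -/
def holFunctions (p : G →+ V) (W : Set (Torus p)) : Submodule ℂ (V → ℂ) :=
  (LineBundle.trivial p).sections W

end General

/-! ### Direct images along the second projection of a product of tori -/

section DirectImage

variable {G G' V V' : Type*} [AddCommGroup G] [AddCommGroup G']
  [NormedAddCommGroup V] [NormedSpace ℂ V] [NormedAddCommGroup V'] [NormedSpace ℂ V']
  {p : G →+ V} {q : G' →+ V'}

/-- The second projection `π₂` of a product of two tori. -/
def proj₂ (p : G →+ V) (q : G' →+ V') : Torus (p.prodMap q) →+ Torus q :=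
  QuotientAddGroup.map _ _ (AddMonoidHom.snd V V') (by
    rintro _ ⟨g, rfl⟩
    exact ⟨g.2, rfl⟩)

/-- The direct image sheaf: sections of `π₂_* L` over `W` are sections of `L` over `π₂⁻¹ W`. -/
def directImage (L : LineBundle (p.prodMap q)) (W : Set (Torus q)) : Submodule ℂ (V × V' → ℂ) :=
  L.sections (proj₂ p q ⁻¹' W)

/-- The restriction of a line bundle to the slice `M × {μ}`. -/
def slice (L : LineBundle (p.prodMap q)) (μ : V') : LineBundle p :=
  L.pullback (fun z => (z, μ)) (by fun_prop) (AddMonoidHom.inl G G') (by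
    intro g v; simp)

/-- The restriction of a line bundle to the slice `{x} × M'`. -/
def slice' (L : LineBundle (p.prodMap q)) (x : V) : LineBundle q :=
  L.pullback (fun w => (x, w)) (by fun_prop) (AddMonoidHom.inr G G') (by
    intro g v; simp)

/-- The restriction of a Hermitian metric to the slice `M × {μ}`. -/
def sliceMetric {L : LineBundle (p.prodMap q)} (H : L.HermitianMetric) (μ : V') :
    (slice L μ).HermitianMetric where
  h z := H.h (z, μ)
  smooth := H.smooth.comp (contDiff_id.prodMk contDiff_const)
  pos _ := H.pos _
  invariant g v := by
    have := H.invariant (g, 0) (v, μ)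
    simpa [slice, LineBundle.pullback] using this

/-- The fibre `H⁰(M, L|_{M × {μ}})` of the direct image at `μ`. -/
def fibre (L : LineBundle (p.prodMap q)) (μ : V') : Submodule ℂ (V → ℂ) := (slice L μ).H0

/-- A holomorphic frame of the direct image over `W`: finitely many sections over `W` whose
values form a basis of the fibre at every point of `W`. -/
def IsHolFrame (L : LineBundle (p.prodMap q)) (W : Set (Torus q)) {r : ℕ}
    (s : Fin r → V × V' → ℂ) : Prop :=
  (∀ i, s i ∈ directImage L W) ∧ ∀ μ ∈ cover q W,
    LinearIndependent ℂ (fun i : Fin r => fun z : V => s i (z, μ)) ∧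
    Submodule.span ℂ (Set.range fun i : Fin r => fun z : V => s i (z, μ)) = fibre L μ

/-- The line spanned by the value of `θ` at `μ`. -/
def lineFibre (θ : V × V' → ℂ) (μ : V') : Submodule ℂ (V → ℂ) :=
  Submodule.span ℂ {fun z => θ (z, μ)}

/-- The sections over `W` of the subbundle of the direct image with fibres `lineFibre θ μ`. -/
def lineSections (L : LineBundle (p.prodMap q)) (θ : V × V' → ℂ) (W : Set (Torus q)) :
    Submodule ℂ (V × V' → ℂ) where
  carrier := {s | s ∈ directImage L W ∧ ∀ μ ∈ cover q W, (fun z => s (z, μ)) ∈ lineFibre θ μ}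
  zero_mem' := ⟨zero_mem _, fun _ _ => zero_mem _⟩
  add_mem' := fun hs ht => ⟨add_mem hs.1 ht.1, fun μ hμ => add_mem (hs.2 μ hμ) (ht.2 μ hμ)⟩
  smul_mem' := fun c _ hs =>
    ⟨Submodule.smul_mem _ c hs.1, fun μ hμ => Submodule.smul_mem _ c (hs.2 μ hμ)⟩

end DirectImage

/-! ### Lattices in `ℂ` and the `L²` metric -/

/-- The period map `(a, b) ↦ a ω₁ + b ω₂`. -/
def periods (ω₁ ω₂ : ℂ) : ℤ × ℤ →+ ℂ where
  toFun g := g.1 * ω₁ + g.2 * ω₂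
  map_zero' := by simp
  map_add' g g' := by simp only [Prod.fst_add, Prod.snd_add, Int.cast_add]; ring

/-- The half-open period parallelogram, a fundamental domain of `ℤ ω₁ + ℤ ω₂`. -/
def parallelogram (ω₁ ω₂ : ℂ) : Set ℂ :=
  {z | ∃ a ∈ Set.Ico (0 : ℝ) 1, ∃ b ∈ Set.Ico (0 : ℝ) 1, z = a * ω₁ + b * ω₂}

/-- The `L²` inner product `∫_M h s t̄ (i/2) dz ∧ dz̄` on the sections of a Hermitian line
bundle on `M = ℂ / (ℤ ω₁ + ℤ ω₂)`; the form `(i/2) dz ∧ dz̄` is Lebesgue measure. -/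
def l2Inner {ω₁ ω₂ : ℂ} {L : LineBundle (periods ω₁ ω₂)} (H : L.HermitianMetric)
    (s t : ℂ → ℂ) : ℂ :=
  ∫ z in parallelogram ω₁ ω₂, (H.h z : ℂ) * s z * (starRingEnd ℂ) (t z)

/-- The Gram matrix at `μ`, for the `L²` metric on the fibres, of sections of a
direct image. -/
def gram {ω₁ ω₂ : ℂ} {q : ℤ × ℤ →+ ℂ} {L : LineBundle ((periods ω₁ ω₂).prodMap q)}
    (H : L.HermitianMetric) {r : ℕ} (s : Fin r → ℂ × ℂ → ℂ) (μ : ℂ) :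
    Matrix (Fin r) (Fin r) ℂ :=
  Matrix.of fun i j => l2Inner (sliceMetric H μ) (fun z => s i (z, μ)) (fun z => s j (z, μ))

/-! ### The curvature of the Chern connection -/

/-- The Wirtinger derivative `∂f/∂μ`. -/
def dWirt (f : ℂ → ℂ) (μ : ℂ) : ℂ := (fderiv ℝ f μ 1 - Complex.I * fderiv ℝ f μ Complex.I) / 2

/-- The Wirtinger derivative `∂f/∂μ̄`. -/
def dbarWirt (f : ℂ → ℂ) (μ : ℂ) : ℂ :=
  (fderiv ℝ f μ 1 + Complex.I * fderiv ℝ f μ Complex.I) / 2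

/-- The Chern connection matrix `∂H · H⁻¹` (coefficient of `dμ`) in a holomorphic frame
with Gram matrix `H i j = (s i, s j)`. -/
def chernConnection {r : ℕ} (H : ℂ → Matrix (Fin r) (Fin r) ℂ) (μ : ℂ) :
    Matrix (Fin r) (Fin r) ℂ :=
  (Matrix.of fun i j => dWirt (fun w => H w i j) μ) * (H μ)⁻¹

/-- The curvature matrix `∂̄(∂H · H⁻¹)` (coefficient of `dμ̄ ∧ dμ`) of the Chern connection. -/
def chernCurvature {r : ℕ} (H : ℂ → Matrix (Fin r) (Fin r) ℂ) (μ : ℂ) :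
    Matrix (Fin r) (Fin r) ℂ :=
  Matrix.of fun i j => dbarWirt (fun w => chernConnection H w i j) μ

/-! ### The line bundles `L₀`, `P`, `K̃` -/

section Bundles

variable (δ : ℕ) (τ : UpperHalfPlane)

/-- The lattice of `M`: in the coordinate `z` of `V`, `λ₁ = δ` and `λ₂ = τ`. -/
def perM : ℤ × ℤ →+ ℂ := periods δ τ

/-- The lattice of the dual torus `M̂`: in the coordinate `μ̂` it is `ℤ + ℤ τ/δ`. -/
def perDual : ℤ × ℤ →+ ℂ := periods 1 (τ / δ)

/-- The line bundle `L₀`, with multipliers `1` for `λ₁` and `exp(-2πi z - πi τ)` for `λ₂`. -/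
def L0 : LineBundle (perM δ τ) where
  mult g z := Complex.exp (-2 * Real.pi * Complex.I * g.2 * z - Real.pi * Complex.I * g.2 ^ 2 * τ)
  holo g := by fun_prop
  ne_zero g v := Complex.exp_ne_zero _
  cocycle g g' v := by
    rw [← Complex.exp_add, Complex.exp_eq_exp_iff_exists_int]
    refine ⟨g.1 * δ * g'.2, ?_⟩
    simp only [perM, periods, AddMonoidHom.coe_mk, ZeroHom.coe_mk, Prod.snd_add]
    push_cast
    ring

/-- The line bundle `L_μ = T_μ^* L₀`, where `T_μ` is translation by `μ`. -/
def Ltrans (μ : ℂ) : LineBundle (perM δ τ) :=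
  (L0 δ τ).pullback (fun z => z + μ) (by fun_prop) (AddMonoidHom.id _) (by
    intro g v; simp only [AddMonoidHom.id_apply]; ring)

/-- The degree-zero line bundle on `M` with parameter `μ̂ ∈ M̂ = Pic⁰(M)`: the flat bundle
of the class of `σ dz̄ = μ̂ e₁*` in `H^{0,1}(M)`, where `e₁* = -i/(2 Im τ) dz̄`;
its multipliers are the constants `exp(2πi σ λ̄)`. -/
def flatBundle (w : ℂ) : LineBundle (perM δ τ) where
  mult g _ := Complex.exp (2 * Real.pi * Complex.I * (-Complex.I / (2 * τ.im) * w) *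
    (starRingEnd ℂ) (perM δ τ g))
  holo g := differentiable_const _
  ne_zero g v := Complex.exp_ne_zero _
  cocycle g g' v := by
    rw [← Complex.exp_add, map_add, map_add]
    congr 1
    ring

/-- The Poincaré line bundle `P` on `M × M̂`; see `poincare_slice` and `poincare_slice'` for
its two characteristic properties. -/
def poincare [NeZero δ] : LineBundle ((perM δ τ).prodMap (perDual δ τ)) where
  mult g v := Complex.exp (-2 * Real.pi * Complex.I *
    (g.1.2 * v.2 + g.2.2 * v.1 / δ + g.1.2 * g.2.2 * τ / δ))
  holo g := by fun_prop
  ne_zero g v := Complex.exp_ne_zero _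
  cocycle g g' v := by
    have hδ : (δ : ℂ) ≠ 0 := Nat.cast_ne_zero.mpr (NeZero.ne δ)
    rw [← Complex.exp_add, Complex.exp_eq_exp_iff_exists_int]
    refine ⟨g'.1.2 * g.2.1 + g'.2.2 * g.1.1, ?_⟩
    simp only [perM, perDual, periods, AddMonoidHom.coe_prodMap, AddMonoidHom.coe_mk,
      ZeroHom.coe_mk, Prod.map, Prod.fst_add, Prod.snd_add]
    push_cast
    field_simp
    ring

/-- The restriction of `P` to `M × {μ̂}` is the line bundle with parameter `μ̂`. -/
theorem poincare_slice [NeZero δ] (w : ℂ) :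
    (slice (poincare δ τ) w).Isomorphic (flatBundle δ τ w) := by
  have hτ : (τ.im : ℂ) ≠ 0 := by exact_mod_cast τ.im_pos.ne'
  refine ⟨fun z => Complex.exp (2 * Real.pi * Complex.I * (-Complex.I / (2 * τ.im) * w) * z),
    by fun_prop, fun v => Complex.exp_ne_zero _, fun g v => ?_⟩
  have h1 : (starRingEnd ℂ) (τ : ℂ) = τ - 2 * Complex.I * τ.im := by
    refine Complex.ext (by simp) ?_
    simp
    ring
  have h2 : (slice (poincare δ τ) w).mult g v = Complex.exp (-2 * Real.pi * Complex.I *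
      (g.2 * w)) := by
    simp [slice, LineBundle.pullback, poincare]
  rw [h2]
  simp only [flatBundle]
  rw [← Complex.exp_add, ← Complex.exp_add]
  congr 1
  simp only [perM, periods, AddMonoidHom.coe_mk, ZeroHom.coe_mk, map_add, map_mul, map_intCast,
    map_natCast, h1]
  field_simp
  ring_nf
  simp only [Complex.I_sq]
  ring

/-- The restriction of `P` to `{0} × M̂` is trivial. -/
theorem poincare_slice' [NeZero δ] :
    (slice' (poincare δ τ) 0).Isomorphic (LineBundle.trivial _) := by
  refine ⟨fun _ => 1, differentiable_const _, fun _ => one_ne_zero, fun g v => ?_⟩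
  simp [slice', LineBundle.pullback, poincare, LineBundle.trivial]

/-- The map `Id × φ` from `M × M` to `M × M̂`, on period groups; here `φ` is the map
`[μ] ↦ T_μ^* L₀ ⊗ L₀^*`, whose lift is `μ ↦ μ` in the coordinates of `V` and of the
universal cover of `M̂` (see `phi_spec`), so that `λ₁ ↦ δ · 1` and `λ₂ ↦ δ · (τ/δ)`. -/
def idPhi : (ℤ × ℤ) × (ℤ × ℤ) →+ (ℤ × ℤ) × (ℤ × ℤ) :=
  (AddMonoidHom.id _).prodMap (δ • AddMonoidHom.id _)

/-- The line bundle on `M` with parameter `φ(μ)` is `T_μ^* L₀ ⊗ L₀^*`. -/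
theorem phi_spec [NeZero δ] (μ : ℂ) :
    (flatBundle δ τ μ).Isomorphic ((Ltrans δ τ μ).tensor (L0 δ τ).dual) := by
  obtain ⟨f, hf, hf0, h⟩ := poincare_slice δ τ μ
  refine ⟨fun z => (f z)⁻¹, hf.inv hf0, fun v => inv_ne_zero (hf0 v), fun g v => ?_⟩
  have h2 : (slice (poincare δ τ) μ).mult g v =
      ((Ltrans δ τ μ).tensor (L0 δ τ).dual).mult g v := by
    simp only [slice, LineBundle.pullback, poincare, LineBundle.tensor, LineBundle.dual, Ltrans,
      L0, AddMonoidHom.inl_apply, AddMonoidHom.id_apply]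
    rw [← Complex.exp_neg, ← Complex.exp_add]
    congr 1
    simp
    ring
  rw [← h2]
  have h3 := h g v
  have := hf0 v
  have := hf0 (v + perM δ τ g)
  field_simp
  linear_combination -h3

/-- The line bundle `K̃ = π₁^* L₀ ⊗ (Id × φ)^* P ⊗ π₂^* L₀` on `M × M`. -/
def Ktilde [NeZero δ] : LineBundle ((perM δ τ).prodMap (perM δ τ)) :=
  (((L0 δ τ).pullback Prod.fst (by fun_prop) (AddMonoidHom.fst _ _) (by intros; rfl)).tensor
    ((poincare δ τ).pullback id differentiable_id (idPhi δ) (by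
      have hδ : (δ : ℂ) ≠ 0 := Nat.cast_ne_zero.mpr (NeZero.ne δ)
      rintro ⟨g, g'⟩ v
      refine Prod.ext rfl ?_
      simp [idPhi, perM, perDual, periods]
      field_simp))).tensor
    ((L0 δ τ).pullback Prod.snd (by fun_prop) (AddMonoidHom.snd _ _) (by intros; rfl))

/-- The metric `h(z, μ) = exp(-(2π / Im τ) (Im z + Im μ)²)` on `K̃`. -/
def hK [NeZero δ] : (Ktilde δ τ).HermitianMetric where
  h v := Real.exp (-2 * Real.pi / τ.im * (v.1.im + v.2.im) ^ 2)
  smooth := by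
    have h1 : ContDiff ℝ ∞ fun v : ℂ × ℂ => v.1.im := Complex.imCLM.contDiff.comp contDiff_fst
    have h2 : ContDiff ℝ ∞ fun v : ℂ × ℂ => v.2.im := Complex.imCLM.contDiff.comp contDiff_snd
    exact (contDiff_const.mul ((h1.add h2).pow 2)).exp
  pos v := Real.exp_pos _
  invariant g v := by
    have hδ : (δ : ℂ) ≠ 0 := Nat.cast_ne_zero.mpr (NeZero.ne δ)
    have hτ : τ.im ≠ 0 := τ.im_pos.ne'
    have h1 : (Ktilde δ τ).mult g v = Complex.exp (-2 * Real.pi * Complex.I *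
        ((g.1.2 + g.2.2 : ℤ) : ℂ) * (v.1 + v.2) -
        Real.pi * Complex.I * ((g.1.2 + g.2.2 : ℤ) : ℂ) ^ 2 * τ) := by
      simp only [Ktilde, LineBundle.tensor, LineBundle.pullback, L0, poincare, idPhi,
        AddMonoidHom.coe_fst, AddMonoidHom.coe_snd, AddMonoidHom.coe_prodMap, Prod.map, id]
      rw [← Complex.exp_add, ← Complex.exp_add]
      congr 1
      simp
      field_simp
      ring
    have h2 : (-2 * Real.pi * Complex.I *
        ((g.1.2 + g.2.2 : ℤ) : ℂ) * (v.1 + v.2) -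
        Real.pi * Complex.I * ((g.1.2 + g.2.2 : ℤ) : ℂ) ^ 2 * τ).re =
        2 * Real.pi * ((g.1.2 + g.2.2 : ℤ) : ℝ) * (v.1.im + v.2.im) +
        Real.pi * ((g.1.2 + g.2.2 : ℤ) : ℝ) ^ 2 * τ.im := by
      rw [show (-2 * Real.pi * Complex.I *
        ((g.1.2 + g.2.2 : ℤ) : ℂ) * (v.1 + v.2) -
        Real.pi * Complex.I * ((g.1.2 + g.2.2 : ℤ) : ℂ) ^ 2 * τ) =
        Complex.I * (((-2 * Real.pi * ((g.1.2 + g.2.2 : ℤ) : ℝ) : ℝ) : ℂ) * (v.1 + v.2) -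
        ((Real.pi * ((g.1.2 + g.2.2 : ℤ) : ℝ) ^ 2 : ℝ) : ℂ) * τ) by push_cast; ring]
      rw [Complex.I_mul_re, Complex.sub_im, Complex.im_ofReal_mul, Complex.im_ofReal_mul,
        Complex.add_im]
      simp only [UpperHalfPlane.coe_im]
      ring
    rw [h1, Complex.norm_exp, h2, ← Real.exp_nat_mul, ← Real.exp_add]
    congr 1
    simp [perM, periods]
    field_simp
    ring

/-- The theta function `θ_m(z, μ)`. -/
def theta (m : Fin δ) (v : ℂ × ℂ) : ℂ :=
  ∑' k : ℤ, Complex.exp (Real.pi * Complex.I * k ^ 2 * τ) *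
    Complex.exp (2 * Real.pi * Complex.I * τ * (m / δ) * k) *
    Complex.exp (2 * Real.pi * Complex.I * ((k * δ + m) / δ) * (v.1 + v.2))

end Bundles

end ThetaBundle

end

/-! Everything rests on one observation: `K̃` is the pull-back of `L₀` along addition `(z, μ) ↦ z +
μ`. The Poincaré factor supplies exactly the cross terms that turn `L₀ ⊠ L₀` into this pull-back
(`Ktilde_mult`). Hence the fibre of `K` at `μ` consists of the functions `f(z + μ)` with `f ∈
H⁰(L₀)`, and `K` is trivial with fibre `H⁰(L₀)`. The metric `h` also depends on `z + μ` alone, and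
integrals of periodic functions over `M` are translation invariant, so the `L²` metric is constant
in this trivialization (`l2Inner_eq_pairing`).

It remains to see that the `θ_m` are a basis of `H⁰(L₀)`. Translation by `1` acts on this space with
order dividing `δ`, and each section is the sum of its eigencomponents. The `ζ^m`-eigenspace is
carried to the functions with the quasi-periodicity of the Jacobi theta function, and these form a
line because their Fourier coefficients obey a two-term recurrence (`exists_eq_mul_jacobiTheta₂`,
`eq_sum_thetaCoeff`).

In any holomorphic frame the Gram matrix is therefore `A G A*` with `A` holomorphic and `G` constant
(`gram_eq`). Then `∂H · H⁻¹ = ∂A · A⁻¹` is holomorphic and the curvature vanishes. -/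

noncomputable section

namespace ThetaBundle

section

open Complex

/-! ### Entire functions with the quasi-periodicity of the Jacobi theta function -/

/-- The `n`-th Fourier coefficient of the restriction of `f` to the real line. -/
def realFourier (f : ℂ → ℂ) (n : ℤ) : ℂ :=
  ∫ x in (0 : ℝ)..1, exp (-(2 * Real.pi * I * n * x)) * f x

/-- A continuous function of period one, all of whose Fourier coefficients on the real line
vanish, vanishes on the real line. -/
theorem eq_zero_of_realFourier_eq_zero {f : ℂ → ℂ} (hf : Continuous f)
    (h1 : ∀ w, f (w + 1) = f w) (h : ∀ n, realFourier f n = 0) (x : ℝ) : f x = 0 := by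
  have hper : Function.Periodic (fun x : ℝ => f x) 1 := fun x => by
    simpa using h1 x
  let F : C(AddCircle (1 : ℝ), ℂ) := ⟨hper.lift, continuous_quot_lift _ (by fun_prop)⟩
  have hF : ∀ x : ℝ, F (x : AddCircle (1 : ℝ)) = f x := fun x => hper.lift_coe x
  have hc : fourierCoeff F = 0 := by
    funext n
    rw [fourierCoeff_eq_intervalIntegral F n 0]
    simp only [hF, fourier_coe_apply, smul_eq_mul]
    have := h n
    rw [realFourier] at this
    simp only [zero_add, div_one, one_smul, Pi.zero_apply]
    rw [← this]
    congr 1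
    ext x
    congr 2
    push_cast
    ring
  -- The zero sequence is summable, so the Fourier series converges to `F`; no regularity beyond
  -- continuity is needed.
  have hs := hasSum_fourier_series_of_summable (f := F) (by rw [hc]; exact summable_zero)
  rw [hc] at hs
  have h0 : F = 0 := by
    have e : (fun i : ℤ => (0 : ℤ → ℂ) i • (fourier i : C(AddCircle (1 : ℝ), ℂ))) =
        fun _ => 0 := by
      ext i x
      simp
    rw [e] at hs
    exact hs.unique hasSum_zero
  rw [← hF, h0]
  rfl

/-- The integral of an entire function of period one over a period does not change when the
segment is shifted. -/
theorem integral_period_add {F : ℂ → ℂ} (hF : Differentiable ℂ F) (h1 : ∀ w, F (w + 1) = F w)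
    (t : ℂ) : ∫ x in (0 : ℝ)..1, F (x + t) = ∫ x in (0 : ℝ)..1, F x := by
  -- Cauchy's theorem on a rectangle of width one: the vertical sides cancel by periodicity. This
  -- shifts by `Im t`; the shift by `Re t` is periodicity on a horizontal line.
  have hR := Complex.integral_boundary_rect_eq_zero_of_differentiableOn F 0 (1 + t.im * I)
    hF.differentiableOn
  have hv : ∀ y : ℝ, F (1 + y * I) = F (y * I) := fun y => by
    rw [add_comm, h1]
  simp [hv] at hR
  have hper : Function.Periodic (fun x : ℝ => F (x + t.im * I)) 1 := fun x => by
    simpa [add_right_comm] using h1 (x + t.im * I)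
  have hs := hper.intervalIntegral_add_eq t.re 0
  have h2 : ∫ x in (0 : ℝ)..1, F (x + t) = ∫ x in t.re..t.re + 1, F (x + t.im * I) := by
    have := intervalIntegral.integral_comp_add_right (a := 0) (b := 1)
      (fun x : ℝ => F (x + t.im * I)) t.re
    rw [zero_add, add_comm 1] at this
    rw [← this]
    congr 1
    ext x
    congr 1
    push_cast
    rw [add_assoc, Complex.re_add_im]
  rw [h2, hs, zero_add]
  exact (sub_eq_zero.mp hR).symm

variable {τ : ℂ}

/-- The Fourier coefficients of a quasi-periodic entire function satisfy a recurrence. -/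
theorem realFourier_succ {g : ℂ → ℂ} (hg : Differentiable ℂ g) (h1 : ∀ w, g (w + 1) = g w)
    (hτ : ∀ w, g (w + τ) = exp (-2 * Real.pi * I * w - Real.pi * I * τ) * g w) (n : ℤ) :
    realFourier g n = exp (-(2 * Real.pi * I * n * τ) - Real.pi * I * τ) *
      realFourier g (n + 1) := by
  have hF : Differentiable ℂ fun w => exp (-(2 * Real.pi * I * n * w)) * g w := by fun_prop
  -- Moving the segment by `τ` brings in the multiplier, whose factor `exp(-2πi w)` raises the
  -- frequency from `n` to `n + 1`.
  have := integral_period_add hF (fun w => by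
    rw [h1]
    congr 1
    rw [Complex.exp_eq_exp_iff_exists_int]
    exact ⟨-n, by push_cast; ring⟩) τ
  rw [realFourier, ← this, realFourier, ← intervalIntegral.integral_const_mul]
  congr 1
  ext x
  rw [hτ, ← mul_assoc, ← mul_assoc, ← Complex.exp_add, ← Complex.exp_add]
  congr 2
  push_cast
  ring

/-- The factor in the recurrence never vanishes, so vanishing spreads from index `0` in both
directions. -/
theorem realFourier_eq_zero {g : ℂ → ℂ} (hg : Differentiable ℂ g) (h1 : ∀ w, g (w + 1) = g w)
    (hτ : ∀ w, g (w + τ) = exp (-2 * Real.pi * I * w - Real.pi * I * τ) * g w)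
    (h0 : realFourier g 0 = 0) (n : ℤ) : realFourier g n = 0 := by
  induction n using Int.induction_on with
  | zero => exact h0
  | succ k ih =>
    have := realFourier_succ hg h1 hτ k
    rw [ih] at this
    exact (mul_eq_zero.mp this.symm).resolve_left (Complex.exp_ne_zero _)
  | pred k ih =>
    rw [realFourier_succ hg h1 hτ, sub_add_cancel, ih, mul_zero]

/-- A quasi-periodic entire function whose zeroth Fourier coefficient vanishes is zero. -/
theorem eq_zero_of_quasiPeriodic {g : ℂ → ℂ} (hg : Differentiable ℂ g)
    (h1 : ∀ w, g (w + 1) = g w)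
    (hτ : ∀ w, g (w + τ) = exp (-2 * Real.pi * I * w - Real.pi * I * τ) * g w)
    (h0 : realFourier g 0 = 0) : g = 0 := by
  have hx := eq_zero_of_realFourier_eq_zero hg.continuous h1 (realFourier_eq_zero hg h1 hτ h0)
  -- Identity theorem, with the real points `1/(n+1)` accumulating at `0`.
  refine AnalyticOnNhd.eq_of_frequently_eq (z₀ := 0) (fun z _ => hg.analyticAt z)
    (fun z _ => analyticAt_const) ?_
  have ht : Filter.Tendsto (fun n : ℕ => (((1 : ℝ) / ((n : ℝ) + 1) : ℝ) : ℂ)) Filter.atTop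
      (nhdsWithin 0 {0}ᶜ) := by
    refine tendsto_nhdsWithin_iff.mpr ⟨?_, Filter.Eventually.of_forall fun n => ?_⟩
    · have := (Complex.continuous_ofReal.tendsto 0).comp
        (tendsto_one_div_add_atTop_nhds_zero_nat (𝕜 := ℝ))
      exact this
    · have : (0 : ℝ) < 1 / ((n : ℝ) + 1) := by positivity
      simpa using Complex.ofReal_ne_zero.mpr this.ne'
  exact ht.frequently (Filter.Frequently.of_forall fun n => hx _)

/-- This normalization makes the zeroth coefficient of `g` the constant in `g = c ϑ`, and shows `ϑ ≠
0`. Termwise integration is allowed because the norm of a term does not depend on the real variable.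
-/
theorem realFourier_jacobiTheta₂ (hτ : 0 < τ.im) :
    realFourier (fun w => jacobiTheta₂ w τ) 0 = 1 := by
  let f : ℤ → C(ℝ, ℂ) := fun n =>
    ⟨fun x => jacobiTheta₂_term n x τ, by unfold jacobiTheta₂_term; fun_prop⟩
  have hsum : Summable fun n => ‖(f n).restrict
      (⟨Set.uIcc (0 : ℝ) 1, isCompact_uIcc⟩ : TopologicalSpace.Compacts ℝ)‖ := by
    refine Summable.of_nonneg_of_le (fun n => norm_nonneg _) (fun n => ?_)
      ((summable_jacobiTheta₂_term_iff 0 τ).mpr hτ).norm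
    refine (ContinuousMap.norm_le _ (norm_nonneg _)).mpr fun x => ?_
    simp [f, norm_jacobiTheta₂_term]
  have h1 := intervalIntegral.hasSum_intervalIntegral_of_summable_norm hsum
  have h2 : ∀ n : ℤ, ∫ x in (0 : ℝ)..1, f n x = if n = 0 then 1 else 0 := by
    intro n
    simp only [f, ContinuousMap.coe_mk, jacobiTheta₂_term]
    split_ifs with hn
    · simp [hn]
    · have hc : 2 * (Real.pi : ℂ) * I * n ≠ 0 := by
        simp [Real.pi_ne_zero, hn]
      have h3 : exp (2 * Real.pi * I * n) = 1 := by
        rw [Complex.exp_eq_one_iff]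
        exact ⟨n, by ring⟩
      simp only [Complex.exp_add]
      rw [intervalIntegral.integral_mul_const, integral_exp_mul_complex hc]
      simp [h3]
  simp only [h2] at h1
  have h4 := h1.unique (hasSum_ite_eq (0 : ℤ) (1 : ℂ))
  simp only [realFourier, Int.cast_zero, mul_zero, zero_mul, neg_zero, exp_zero, one_mul]
  exact h4

theorem differentiable_jacobiTheta₂ (hτ : 0 < τ.im) :
    Differentiable ℂ fun w => jacobiTheta₂ w τ :=
  fun w => differentiableAt_jacobiTheta₂_fst w hτ

/-- The quasi-periodic entire functions are the multiples of the Jacobi theta function. -/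
theorem exists_eq_mul_jacobiTheta₂ (hτ : 0 < τ.im) {g : ℂ → ℂ} (hg : Differentiable ℂ g)
    (h1 : ∀ w, g (w + 1) = g w)
    (h2 : ∀ w, g (w + τ) = exp (-2 * Real.pi * I * w - Real.pi * I * τ) * g w) :
    ∃ c : ℂ, ∀ w, g w = c * jacobiTheta₂ w τ := by
  have hd := differentiable_jacobiTheta₂ hτ
  have := eq_zero_of_quasiPeriodic (τ := τ)
    (g := fun w => g w - realFourier g 0 * jacobiTheta₂ w τ) (by fun_prop)
    (fun w => by simp only [h1, jacobiTheta₂_add_left])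
    (fun w => by
      simp only [h2, jacobiTheta₂_add_left']
      rw [show -(Real.pi : ℂ) * I * (τ + 2 * w) = -2 * Real.pi * I * w - Real.pi * I * τ by ring]
      ring) (by
      have h3 := realFourier_jacobiTheta₂ hτ
      simp only [realFourier, Int.cast_zero, mul_zero, zero_mul, neg_zero, exp_zero, one_mul]
        at h3 ⊢
      have c1 : Continuous fun x : ℝ => g x := hg.continuous.comp Complex.continuous_ofReal
      have c2 : Continuous fun x : ℝ => jacobiTheta₂ x τ :=
        hd.continuous.comp Complex.continuous_ofReal
      rw [intervalIntegral.integral_sub (c1.intervalIntegrable _ _)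
        (Continuous.intervalIntegrable (by fun_prop) _ _),
        intervalIntegral.integral_const_mul, h3, mul_one, sub_self])
  exact ⟨realFourier g 0, fun w => sub_eq_zero.mp (congrFun this w)⟩

end

section

open Complex

/-! ### The sections of `L₀` -/

/-- The automorphy property for all periods follows from that for the two generators. -/
theorem automorphic_of_generators {V : Type*} [NormedAddCommGroup V] [NormedSpace ℂ V]
    {p : ℤ × ℤ →+ V} (L : LineBundle p) {s : V → ℂ}
    (h1 : ∀ v, s (v + p (1, 0)) = L.mult (1, 0) v * s v)
    (h2 : ∀ v, s (v + p (0, 1)) = L.mult (0, 1) v * s v) (g : ℤ × ℤ) (v : V) :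
    s (v + p g) = L.mult g v * s v := by
  have hmul0 : ∀ v, L.mult 0 v = 1 := fun v => by
    have := L.cocycle 0 0 v
    rw [add_zero, map_zero, add_zero] at this
    exact (mul_eq_left₀ (L.ne_zero 0 v)).mp this.symm
  -- By the cocycle identity the periods with the automorphy property form a subgroup.
  let S : AddSubgroup (ℤ × ℤ) :=
    { carrier := {g | ∀ v, s (v + p g) = L.mult g v * s v}
      zero_mem' := fun v => by rw [map_zero, add_zero, hmul0, one_mul]
      add_mem' := fun {g g'} hg hg' v => by
        rw [map_add, ← add_assoc, hg', hg, L.cocycle, mul_assoc]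
      neg_mem' := fun {g} hg v => by
        have h3 := hg (v + p (-g))
        have h4 := L.cocycle (-g) g v
        rw [neg_add_cancel, hmul0] at h4
        rw [map_neg, neg_add_cancel_right] at h3
        rw [map_neg] at h4 ⊢
        rw [h3, ← mul_assoc, mul_comm (L.mult (-g) v), ← h4, one_mul] }
  have h3 : g = g.1 • ((1 : ℤ), (0 : ℤ)) + g.2 • ((0 : ℤ), (1 : ℤ)) := by
    ext <;> simp
  have h4 : g ∈ S := by
    rw [h3]
    exact add_mem (zsmul_mem (show _ ∈ S from h1) _) (zsmul_mem (show _ ∈ S from h2) _)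
  exact h4 v

variable (δ : ℕ) (τ : UpperHalfPlane)

theorem mem_H0_L0_iff {f : ℂ → ℂ} : f ∈ (L0 δ τ).H0 ↔ Differentiable ℂ f ∧
    (∀ w, f (w + δ) = f w) ∧
      ∀ w, f (w + τ) = exp (-2 * Real.pi * I * w - Real.pi * I * τ) * f w := by
  constructor
  · rintro ⟨hd, hf, -⟩
    refine ⟨differentiableOn_univ.mp (by simpa [cover] using hd), fun w => ?_, fun w => ?_⟩
    · simpa [perM, periods, L0] using hf (1, 0) w (Set.mem_univ _)
    · simpa [perM, periods, L0] using hf (0, 1) w (Set.mem_univ _)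
  · rintro ⟨hd, h1, h2⟩
    refine ⟨hd.differentiableOn, fun g w _ => automorphic_of_generators (L0 δ τ) (fun w => ?_)
      (fun w => ?_) g w, fun v hv => absurd (Set.mem_univ _) hv⟩
    · simpa [perM, periods, L0] using h1 w
    · simpa [perM, periods, L0] using h2 w

/-- The theta function `θ_m` as a function of `w = z + μ`. -/
def thetaOne (m : Fin δ) (w : ℂ) : ℂ :=
  exp (2 * Real.pi * I * m / δ * w) * jacobiTheta₂ (w + m * τ / δ) τ

/-- The primitive `δ`-th root of unity `exp(2πi/δ)`. -/
def zetaRoot : ℂ := exp (2 * Real.pi * I / δ)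

theorem zetaRoot_ne_zero : zetaRoot δ ≠ 0 := Complex.exp_ne_zero _

/-- The `θ_m` are eigenvectors of the translation by one; the eigenvalue comes from the exponential
factor, as `ϑ` has period one. -/
theorem thetaOne_add_one (m : Fin δ) (w : ℂ) :
    thetaOne δ τ m (w + 1) = zetaRoot δ ^ (m : ℕ) * thetaOne δ τ m w := by
  rw [thetaOne, thetaOne, add_right_comm, jacobiTheta₂_add_left, ← mul_assoc, zetaRoot,
    ← Complex.exp_nat_mul, ← Complex.exp_add]
  congr 2
  ring

theorem thetaOne_ne_zero (m : Fin δ) : ∃ w, thetaOne δ τ m w ≠ 0 := by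
  by_contra! h
  have h1 : ∀ w, jacobiTheta₂ w τ = 0 := fun w => by
    have := h (w - m * τ / δ)
    rw [thetaOne, sub_add_cancel] at this
    exact (mul_eq_zero.mp this).resolve_left (Complex.exp_ne_zero _)
  have h2 := realFourier_jacobiTheta₂ (τ := τ) τ.im_pos
  simp [realFourier, h1] at h2

/-- Character orthogonality on `ℤ/δ`, used for sums over translates and over eigenvalues. -/
theorem sum_pow_eq {x : ℂ} (hx : x ^ δ = 1) :
    ∑ j ∈ Finset.range δ, x ^ j = if x = 1 then (δ : ℂ) else 0 := by
  split_ifs with h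
  · simp [h]
  · rw [geom_sum_eq h, hx, sub_self, zero_div]

theorem thetaOne_add_nat (m : Fin δ) (w : ℂ) (j : ℕ) :
    thetaOne δ τ m (w + j) = (zetaRoot δ ^ (m : ℕ)) ^ j * thetaOne δ τ m w := by
  induction j with
  | zero => simp
  | succ j ih => rw [Nat.cast_succ, ← add_assoc, thetaOne_add_one, ih, pow_succ']; ring

/-- The projection to the `ζ^m`-eigenspace of the translation by one. -/
def eigenProj (m : Fin δ) (f : ℂ → ℂ) (w : ℂ) : ℂ :=
  (δ : ℂ)⁻¹ * ∑ j ∈ Finset.range δ, ((zetaRoot δ ^ (m : ℕ))⁻¹) ^ j * f (w + j)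

/-- A point at which `θ_m` does not vanish. -/
def basePoint (m : Fin δ) : ℂ := (thetaOne_ne_zero δ τ m).choose

/-- The linear functional that gives the coefficient of `θ_m`. -/
def thetaCoeff (m : Fin δ) : (ℂ → ℂ) →ₗ[ℂ] ℂ where
  toFun f := eigenProj δ m f (basePoint δ τ m) / thetaOne δ τ m (basePoint δ τ m)
  map_add' f g := by
    simp only [eigenProj, Pi.add_apply, mul_add, Finset.sum_add_distrib, add_div]
  map_smul' c f := by
    simp only [eigenProj, Pi.smul_apply, smul_eq_mul, RingHom.id_apply, mul_left_comm _ c,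
      ← Finset.mul_sum, mul_div_assoc]

theorem thetaCoeff_apply (m : Fin δ) (f : ℂ → ℂ) : thetaCoeff δ τ m f =
    eigenProj δ m f (basePoint δ τ m) / thetaOne δ τ m (basePoint δ τ m) := rfl

theorem thetaOne_basePoint_ne_zero (m : Fin δ) : thetaOne δ τ m (basePoint δ τ m) ≠ 0 :=
  (thetaOne_ne_zero δ τ m).choose_spec

variable [NeZero δ]

/-- Splitting `exp(2πi m w/δ)` off each term leaves the series of `ϑ` at `w + mτ/δ`, where `w = z +
μ`. -/
theorem theta_eq (m : Fin δ) (v : ℂ × ℂ) : theta δ τ m v = thetaOne δ τ m (v.1 + v.2) := by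
  have hδ : (δ : ℂ) ≠ 0 := Nat.cast_ne_zero.mpr (NeZero.ne δ)
  rw [theta, thetaOne, jacobiTheta₂, ← tsum_mul_left]
  congr 1
  ext k
  rw [jacobiTheta₂_term, ← Complex.exp_add, ← Complex.exp_add, ← Complex.exp_add]
  congr 1
  field_simp
  ring

theorem thetaOne_mem (m : Fin δ) : thetaOne δ τ m ∈ (L0 δ τ).H0 := by
  have hδ : (δ : ℂ) ≠ 0 := Nat.cast_ne_zero.mpr (NeZero.ne δ)
  have hd := differentiable_jacobiTheta₂ (τ := τ) τ.im_pos
  rw [mem_H0_L0_iff]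
  refine ⟨?_, fun w => ?_, fun w => ?_⟩
  · unfold thetaOne
    have : Differentiable ℂ fun w : ℂ => w + m * τ / δ := by fun_prop
    exact Differentiable.mul (by fun_prop) (hd.comp this)
  · have h1 : ∀ (n : ℕ) (w : ℂ), jacobiTheta₂ (w + n) τ = jacobiTheta₂ w τ := by
      intro n w
      induction n with
      | zero => simp
      | succ n ih => rw [Nat.cast_succ, ← add_assoc, jacobiTheta₂_add_left, ih]
    rw [thetaOne, thetaOne, add_right_comm, h1]
    congr 1
    rw [Complex.exp_eq_exp_iff_exists_int]
    exact ⟨(m : ℕ), by push_cast; field_simp⟩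
  -- The shift `mτ/δ` changes the multiplier of `ϑ` by `exp(-2πi mτ/δ)`, which the exponential
  -- prefactor compensates.
  · rw [thetaOne, thetaOne, add_right_comm, jacobiTheta₂_add_left', ← mul_assoc, ← mul_assoc,
      ← Complex.exp_add, ← Complex.exp_add]
    congr 2
    field_simp
    ring

theorem zetaRoot_primitive : IsPrimitiveRoot (zetaRoot δ) δ :=
  Complex.isPrimitiveRoot_exp δ (NeZero.ne δ)

variable {τ} in
/-- A section of `L₀` that is multiplied by `ζ^m` under translation by one is a multiple
of `θ_m`. -/
theorem exists_eq_mul_thetaOne (m : Fin δ) {f : ℂ → ℂ} (hf : Differentiable ℂ f)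
    (h1 : ∀ w, f (w + 1) = zetaRoot δ ^ (m : ℕ) * f w)
    (h2 : ∀ w, f (w + τ) = exp (-2 * Real.pi * I * w - Real.pi * I * τ) * f w) :
    ∃ c : ℂ, ∀ w, f w = c * thetaOne δ τ m w := by
  have hδ : (δ : ℂ) ≠ 0 := Nat.cast_ne_zero.mpr (NeZero.ne δ)
  -- This `g` undoes the passage from `ϑ` to `θ_m`: the exponential removes the eigenvalue `ζ^m`,
  -- and the shift restores the multiplier of `ϑ`.
  obtain ⟨c, key⟩ := exists_eq_mul_jacobiTheta₂ (τ := τ) τ.im_pos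
    (g := fun w => exp (-(2 * Real.pi * I * m / δ * (w - m * τ / δ))) * f (w - m * τ / δ))
    (by
      have : Differentiable ℂ fun w : ℂ => w - m * τ / δ := by fun_prop
      exact Differentiable.mul (by fun_prop) (hf.comp this))
    (fun w => by
      rw [add_sub_right_comm, h1, zetaRoot, ← mul_assoc, ← Complex.exp_nat_mul,
        ← Complex.exp_add]
      congr 2
      ring)
    (fun w => by
      rw [add_sub_right_comm, h2, ← mul_assoc, ← mul_assoc, ← Complex.exp_add,
        ← Complex.exp_add]
      congr 2
      field_simp
      ring)
  refine ⟨c, fun w => ?_⟩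
  have h3 := key (w + m * τ / δ)
  rw [add_sub_cancel_right] at h3
  rw [thetaOne, mul_left_comm, ← h3, ← mul_assoc, ← Complex.exp_add, add_neg_cancel,
    Complex.exp_zero, one_mul]

theorem zetaRoot_pow_pow (m : ℕ) : (zetaRoot δ ^ m) ^ δ = 1 := by
  rw [← pow_mul, mul_comm, pow_mul, (zetaRoot_primitive δ).pow_eq_one, one_pow]

theorem eigenProj_add_one (m : Fin δ) {f : ℂ → ℂ} (hf : ∀ w, f (w + δ) = f w) (w : ℂ) :
    eigenProj δ m f (w + 1) = zetaRoot δ ^ (m : ℕ) * eigenProj δ m f w := by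
  have hx : zetaRoot δ ^ (m : ℕ) ≠ 0 := pow_ne_zero _ (zetaRoot_ne_zero δ)
  have hx1 := zetaRoot_pow_pow δ m
  rw [eigenProj, eigenProj, mul_left_comm]
  congr 1
  -- The sum over `0, …, δ` is split at either end; the end terms agree because both the root of
  -- unity and `f` return after `δ` steps.
  have h1 := Finset.sum_range_succ
    (fun j : ℕ => ((zetaRoot δ ^ (m : ℕ))⁻¹) ^ j * f (w + j)) δ
  rw [Finset.sum_range_succ', inv_pow _ δ, hx1, hf] at h1
  simp only [pow_zero, inv_one, Nat.cast_zero, add_zero] at h1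
  rw [← add_right_cancel h1, Finset.mul_sum]
  refine Finset.sum_congr rfl fun j _ => ?_
  rw [pow_succ]
  push_cast
  rw [show w + 1 + j = w + (j + 1) by ring]
  field_simp

/-- Once the sums are exchanged, the sum of `ζ^(-mj)` over `m` kills every translate but `j = 0`. -/
theorem sum_eigenProj (f : ℂ → ℂ) (w : ℂ) : ∑ m, eigenProj δ m f w = f w := by
  have hδ : (δ : ℂ) ≠ 0 := Nat.cast_ne_zero.mpr (NeZero.ne δ)
  simp only [eigenProj]
  rw [← Finset.mul_sum, Finset.sum_comm]
  have h1 : ∀ j ∈ Finset.range δ,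
      ∑ m : Fin δ, ((zetaRoot δ ^ (m : ℕ))⁻¹) ^ j * f (w + j) =
        if j = 0 then δ * f w else 0 := by
    intro j hj
    rw [← Finset.sum_mul, Fin.sum_univ_eq_sum_range (fun m => ((zetaRoot δ ^ m)⁻¹) ^ j) δ]
    have h2 : ∀ m, ((zetaRoot δ ^ m)⁻¹) ^ j = ((zetaRoot δ ^ j)⁻¹) ^ m := fun m => by
      rw [inv_pow, inv_pow, ← pow_mul, ← pow_mul, mul_comm]
    simp only [h2]
    rw [sum_pow_eq δ (by rw [inv_pow, zetaRoot_pow_pow, inv_one])]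
    by_cases h0 : j = 0
    · simp [h0]
    · have := (zetaRoot_primitive δ).pow_ne_one_of_pos_of_lt h0 (Finset.mem_range.mp hj)
      simp [h0, this]
  rw [Finset.sum_congr rfl h1, Finset.sum_ite_eq' ,
    if_pos (Finset.mem_range.mpr (NeZero.pos δ)), inv_mul_cancel_left₀ hδ]

theorem eigenProj_thetaOne (m l : Fin δ) (w : ℂ) :
    eigenProj δ m (thetaOne δ τ l) w = if l = m then thetaOne δ τ l w else 0 := by
  have hδ : (δ : ℂ) ≠ 0 := Nat.cast_ne_zero.mpr (NeZero.ne δ)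
  simp only [eigenProj, thetaOne_add_nat, ← mul_assoc, ← mul_pow]
  rw [← Finset.sum_mul, sum_pow_eq δ (by rw [mul_pow, inv_pow, zetaRoot_pow_pow,
    zetaRoot_pow_pow, inv_one, one_mul])]
  have h1 : (zetaRoot δ ^ (m : ℕ))⁻¹ * zetaRoot δ ^ (l : ℕ) = 1 ↔ l = m := by
    rw [inv_mul_eq_one₀ (pow_ne_zero _ (zetaRoot_ne_zero δ))]
    exact ⟨fun h => (Fin.ext ((zetaRoot_primitive δ).pow_inj m.2 l.2 h)).symm, fun h => by rw [h]⟩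
  simp only [h1]
  split_ifs with h
  · field_simp
  · simp

theorem thetaCoeff_thetaOne (m l : Fin δ) :
    thetaCoeff δ τ m (thetaOne δ τ l) = if l = m then 1 else 0 := by
  rw [thetaCoeff_apply, eigenProj_thetaOne]
  split_ifs with h
  · rw [h, div_self (thetaOne_basePoint_ne_zero δ τ m)]
  · rw [zero_div]

theorem thetaCoeff_sum (m : Fin δ) (c : Fin δ → ℂ) :
    thetaCoeff δ τ m (∑ l, c l • thetaOne δ τ l) = c m := by
  simp [map_sum, thetaCoeff_thetaOne]

/-- Every section of `L₀` is a linear combination of theta functions. -/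
theorem eq_sum_thetaCoeff {f : ℂ → ℂ} (hf : f ∈ (L0 δ τ).H0) (w : ℂ) :
    f w = ∑ m, thetaCoeff δ τ m f * thetaOne δ τ m w := by
  obtain ⟨hd, h1, h2⟩ := (mem_H0_L0_iff δ τ).mp hf
  rw [← sum_eigenProj δ f w]
  refine Finset.sum_congr rfl fun m _ => ?_
  obtain ⟨c, hc⟩ := exists_eq_mul_thetaOne δ (τ := τ) m (f := eigenProj δ m f)
    (by
      refine Differentiable.const_mul (Differentiable.fun_sum fun j _ => ?_) _
      have : Differentiable ℂ fun w : ℂ => w + j := by fun_prop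
      exact (hd.comp this).const_mul _)
    (eigenProj_add_one δ m h1)
    -- The multiplier for `τ` has period one, so integer translations preserve this
    -- quasi-periodicity.
    (fun w => by
      rw [eigenProj, eigenProj, mul_left_comm]
      congr 1
      rw [Finset.mul_sum]
      refine Finset.sum_congr rfl fun j _ => ?_
      rw [add_right_comm, h2, mul_left_comm]
      congr 1
      rw [Complex.exp_eq_exp_iff_exists_int]
      exact ⟨-j, by push_cast; ring⟩)
  rw [thetaCoeff_apply, hc, hc, mul_div_cancel_right₀ _ (thetaOne_basePoint_ne_zero δ τ m)]

end

section

open Complex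

/-! ### The splitting of the direct image -/

/-- A criterion for a submodule to be the internal direct sum of finitely many submodules. -/
theorem isInternal_submoduleOf {ι V : Type*} [Fintype ι] [DecidableEq ι] [AddCommGroup V]
    [Module ℂ V] {F : Submodule ℂ V} {N : ι → Submodule ℂ V}
    (hle : ∀ i, N i ≤ F)
    (hindep : ∀ x : ι → V, (∀ i, x i ∈ N i) → ∑ i, x i = 0 → ∀ i, x i = 0)
    (hspan : ∀ v ∈ F, ∃ x : ι → V, (∀ i, x i ∈ N i) ∧ ∑ i, x i = v) :
    DirectSum.IsInternal fun i => (N i).submoduleOf F := by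
  classical
  have hsum : ∀ y : DirectSum ι fun i => (N i).submoduleOf F,
      ((DirectSum.coeAddMonoidHom (fun i => (N i).submoduleOf F) y : F) : V) =
        ∑ i, ((y i : F) : V) := fun y => by
    rw [DirectSum.coeAddMonoidHom_eq_dfinsuppSum, DFinsupp.sum_eq_sum_fintype _ (by simp)]
    simp
  refine ⟨(injective_iff_map_eq_zero _).mpr fun y hy => ?_, fun v => ?_⟩
  · have h1 := hsum y
    rw [hy] at h1
    have h2 := hindep (fun i => ((y i : F) : V)) (fun i => (y i).2) h1.symm
    ext i
    exact h2 i
  · obtain ⟨x, hx, hv⟩ := hspan v v.2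
    refine ⟨DirectSum.mk _ Finset.univ fun i => ⟨⟨x i, hle i (hx i)⟩, hx i⟩, Subtype.ext ?_⟩
    rw [hsum, ← hv]
    refine Finset.sum_congr rfl fun i _ => ?_
    rw [DirectSum.mk_apply_of_mem (Finset.mem_univ _)]

variable (δ : ℕ) (τ : UpperHalfPlane) [NeZero δ]

/-- With `b`, `d` the `τ`-components of the two periods, the factor `δ` in `idPhi` cancels the
denominators of `P`, and its terms `bμ + dz + bdτ` complete `bz + dμ` and `b² + d²` to `(b + d)(z +
μ)` and `(b + d)²`. -/
theorem Ktilde_mult (g : (ℤ × ℤ) × (ℤ × ℤ)) (v : ℂ × ℂ) :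
    (Ktilde δ τ).mult g v = (L0 δ τ).mult (g.1 + g.2) (v.1 + v.2) := by
  have hδ : (δ : ℂ) ≠ 0 := Nat.cast_ne_zero.mpr (NeZero.ne δ)
  simp only [Ktilde, LineBundle.tensor, LineBundle.pullback, L0, poincare, idPhi,
    AddMonoidHom.coe_fst, AddMonoidHom.coe_snd, AddMonoidHom.coe_prodMap, Prod.map, id]
  rw [← Complex.exp_add, ← Complex.exp_add]
  congr 1
  simp
  field_simp
  ring

theorem slice_Ktilde_mult (μ : ℂ) (g : ℤ × ℤ) (z : ℂ) :
    (slice (Ktilde δ τ) μ).mult g z = (L0 δ τ).mult g (z + μ) := by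
  simp [slice, LineBundle.pullback, Ktilde_mult]

variable {δ τ}

/-- Together with `comp_sub_mem_H0`, this identifies every fibre with `H⁰(L₀)`. -/
theorem comp_add_mem_fibre {f : ℂ → ℂ} (hf : f ∈ (L0 δ τ).H0) (μ : ℂ) :
    (fun z => f (z + μ)) ∈ fibre (Ktilde δ τ) μ := by
  obtain ⟨hd, h, -⟩ := hf
  replace hd := differentiableOn_univ.mp (by simpa [cover] using hd)
  have ha : Differentiable ℂ fun z : ℂ => z + μ := by fun_prop
  refine ⟨(hd.comp ha).differentiableOn, fun g z _ => ?_, fun v hv => absurd (Set.mem_univ _) hv⟩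
  simp only [slice_Ktilde_mult, add_right_comm z]
  exact h g _ (Set.mem_univ _)

theorem comp_sub_mem_H0 {f : ℂ → ℂ} {μ : ℂ} (hf : f ∈ fibre (Ktilde δ τ) μ) :
    (fun w => f (w - μ)) ∈ (L0 δ τ).H0 := by
  obtain ⟨hd, h, -⟩ := hf
  replace hd := differentiableOn_univ.mp (by simpa [cover] using hd)
  have ha : Differentiable ℂ fun z : ℂ => z - μ := by fun_prop
  refine ⟨(hd.comp ha).differentiableOn, fun g w _ => ?_, fun v hv => absurd (Set.mem_univ _) hv⟩
  have := h g (w - μ) (Set.mem_univ _)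
  rwa [slice_Ktilde_mult, sub_add_cancel, ← add_sub_right_comm] at this

variable (δ τ) in
theorem theta_slice_mem (m : Fin δ) (μ : ℂ) :
    (fun z => theta δ τ m (z, μ)) ∈ fibre (Ktilde δ τ) μ := by
  simp only [theta_eq]
  exact comp_add_mem_fibre (thetaOne_mem δ τ m) μ

variable (τ) in
/-- The coefficient of `θ_m` of a function on `M × M`, as a function of `μ`. -/
def coeffFun (m : Fin δ) (s : ℂ × ℂ → ℂ) (μ : ℂ) : ℂ :=
  thetaCoeff δ τ m fun w => s (w - μ, μ)

theorem eq_sum_coeffFun {s : ℂ × ℂ → ℂ} {μ : ℂ}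
    (hs : (fun z => s (z, μ)) ∈ fibre (Ktilde δ τ) μ) (z : ℂ) :
    s (z, μ) = ∑ m, coeffFun τ m s μ * theta δ τ m (z, μ) := by
  have := eq_sum_thetaCoeff δ τ (comp_sub_mem_H0 hs) (z + μ)
  simp only [add_sub_cancel_right] at this
  simpa only [theta_eq, coeffFun] using this

theorem coeffFun_sum {s : ℂ × ℂ → ℂ} {μ : ℂ} {c : Fin δ → ℂ}
    (hs : ∀ z, s (z, μ) = ∑ l, c l * theta δ τ l (z, μ)) (m : Fin δ) :
    coeffFun τ m s μ = c m := by
  rw [← thetaCoeff_sum δ τ m c, coeffFun]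
  congr 1
  ext w
  simp [hs, theta_eq]

theorem theta_linearIndependent {μ : ℂ} {c : Fin δ → ℂ}
    (h : ∀ z, ∑ l, c l * theta δ τ l (z, μ) = 0) (m : Fin δ) : c m = 0 := by
  rw [← coeffFun_sum (s := 0) (fun z => (h z).symm) m, coeffFun]
  exact map_zero _

variable {W : Set (Torus (perM δ τ))} {s : ℂ × ℂ → ℂ}

theorem slice_mem_fibre (hs : s ∈ directImage (Ktilde δ τ) W) {μ : ℂ}
    (hμ : μ ∈ cover (perM δ τ) W) : (fun z => s (z, μ)) ∈ fibre (Ktilde δ τ) μ := by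
  obtain ⟨hd, h, -⟩ := hs
  refine ⟨fun z _ => ?_, fun g z _ => ?_, fun v hv => absurd (Set.mem_univ _) hv⟩
  · have hi : DifferentiableWithinAt ℂ (fun z : ℂ => (z, μ))
        (cover (perM δ τ) Set.univ) z := by fun_prop
    exact (hd (z, μ) hμ).comp z hi fun z _ => hμ
  · have := h (g, 0) (z, μ) hμ
    simpa [slice, LineBundle.pullback] using this

/-- The coefficient functional is a finite combination of point evaluations, so holomorphy in `μ` is
immediate. -/
theorem differentiableOn_coeffFun (hs : s ∈ directImage (Ktilde δ τ) W) (m : Fin δ) :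
    DifferentiableOn ℂ (coeffFun τ m s) (cover (perM δ τ) W) := by
  have h : ∀ w : ℂ, DifferentiableOn ℂ (fun μ => s (w - μ, μ)) (cover (perM δ τ) W) := by
    intro w μ hμ
    have hi : DifferentiableWithinAt ℂ (fun μ : ℂ => (w - μ, μ)) (cover (perM δ τ) W) μ := by
      fun_prop
    exact (hs.1 (w - μ, μ) hμ).comp (f := fun μ : ℂ => (w - μ, μ)) μ hi fun μ hμ => hμ
  exact ((DifferentiableOn.fun_sum fun j _ => (h _).const_mul _).const_mul _).div_const _

theorem coeffFun_mem (hs : s ∈ directImage (Ktilde δ τ) W) (m : Fin δ) :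
    coeffFun τ m s ∈ holFunctions (perM δ τ) W := by
  refine ⟨differentiableOn_coeffFun hs m, fun g μ hμ => ?_, fun μ hμ => ?_⟩
  · simp only [LineBundle.trivial, one_mul, coeffFun]
    congr 1
    ext w
    -- The period `(-g, g)` fixes `z + μ`, so its multiplier is `1`.
    have := hs.2.1 (-g, g) (w - μ, μ) hμ
    rw [Ktilde_mult, neg_add_cancel, show (L0 δ τ).mult 0 _ = 1 by simp [L0], one_mul] at this
    rw [← this]
    congr 1
    ext
    · simp [sub_eq_add_neg, add_assoc, add_comm]
    · simp
  · rw [coeffFun, show (fun w => s (w - μ, μ)) = 0 from funext fun w => hs.2.2 _ hμ, map_zero]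

theorem theta_mem (m : Fin δ) : theta δ τ m ∈ directImage (Ktilde δ τ) Set.univ := by
  obtain ⟨hd, h, -⟩ := thetaOne_mem δ τ m
  replace hd := differentiableOn_univ.mp (by simpa [cover] using hd)
  have ha : Differentiable ℂ fun v : ℂ × ℂ => v.1 + v.2 := by fun_prop
  rw [show theta δ τ m = fun v => thetaOne δ τ m (v.1 + v.2) from funext (theta_eq δ τ m)]
  refine ⟨(hd.comp ha).differentiableOn, fun g v _ => ?_, fun v hv => absurd (Set.mem_univ _) hv⟩
  rw [Ktilde_mult, ← h _ _ (Set.mem_univ _), map_add]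
  exact congrArg (thetaOne δ τ m) (add_add_add_comm _ _ _ _)

theorem mul_theta_mem {f : ℂ → ℂ} (hf : f ∈ holFunctions (perM δ τ) W) (m : Fin δ) :
    (fun v : ℂ × ℂ => f v.2 * theta δ τ m v) ∈ lineSections (Ktilde δ τ) (theta δ τ m) W := by
  obtain ⟨hd, h, h0⟩ := theta_mem (τ := τ) m
  refine ⟨⟨?_, fun g v hv => ?_, fun v hv => ?_⟩, fun μ _ => ?_⟩
  · refine DifferentiableOn.mul ?_ (hd.mono fun v _ => Set.mem_univ _)
    exact hf.1.comp differentiableOn_snd fun v hv => hv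
  · have h1 := hf.2.1 g.2 v.2 hv
    simp only [LineBundle.trivial, one_mul] at h1
    have h2 := h g v (Set.mem_univ _)
    simp only [Prod.snd_add, AddMonoidHom.coe_prodMap, Prod.map] at h2 ⊢
    rw [h2, h1]
    ring
  · exact mul_eq_zero_of_left (hf.2.2 v.2 hv) _
  · exact Submodule.mem_span_singleton.mpr ⟨f μ, rfl⟩

theorem eq_coeffFun_mul_theta {m : Fin δ}
    (hs : s ∈ lineSections (Ktilde δ τ) (theta δ τ m) W) (v : ℂ × ℂ) :
    s v = coeffFun τ m s v.2 * theta δ τ m v := by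
  by_cases hv : v.2 ∈ cover (perM δ τ) W
  · obtain ⟨c, hc⟩ := Submodule.mem_span_singleton.mp (hs.2 v.2 hv)
    have hc' : ∀ z, s (z, v.2) = c * theta δ τ m (z, v.2) := fun z => (congrFun hc z).symm
    rw [coeffFun_sum (c := Pi.single m c) (fun z => by
      simp [hc', Pi.single_apply]), Pi.single_eq_same]
    exact hc' v.1
  -- Off the preimage of `W`, sections and functions are zero by convention.
  · rw [hs.1.2.2 v hv, (coeffFun_mem hs.1 m).2.2 _ hv, zero_mul]

theorem bijOn_mul_theta (W : Set (Torus (perM δ τ))) (m : Fin δ) : Set.BijOn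
    (fun (f : ℂ → ℂ) (v : ℂ × ℂ) => f v.2 * theta δ τ m v)
    (holFunctions (perM δ τ) W : Set (ℂ → ℂ))
    (lineSections (Ktilde δ τ) (theta δ τ m) W : Set (ℂ × ℂ → ℂ)) := by
  refine ⟨fun f hf => mul_theta_mem hf m, fun f _ f' _ h => ?_, fun s hs => ?_⟩
  · ext μ
    -- For every `μ` this is a point of the slice at which `θ_m` does not vanish.
    have := congrFun h (basePoint δ τ m - μ, μ)
    simp only [theta_eq, sub_add_cancel] at this
    exact mul_right_cancel₀ (thetaOne_basePoint_ne_zero δ τ m) this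
  · exact ⟨coeffFun τ m s, coeffFun_mem hs.1 m,
      (funext (eq_coeffFun_mul_theta hs)).symm⟩

theorem isInternal_lineSections (W : Set (Torus (perM δ τ))) :
    DirectSum.IsInternal fun m : Fin δ =>
      (lineSections (Ktilde δ τ) (theta δ τ m) W).submoduleOf (directImage (Ktilde δ τ) W) := by
  refine isInternal_submoduleOf (fun m s hs => hs.1) (fun x hx h0 m => ?_) fun s hs => ?_
  · ext v
    rw [eq_coeffFun_mul_theta (hx m), theta_linearIndependent (τ := τ) (μ := v.2)
      (c := fun l => coeffFun τ l (x l) v.2) (fun z => ?_) m, zero_mul, Pi.zero_apply]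
    have := congrFun h0 (z, v.2)
    rw [Finset.sum_apply] at this
    rw [← this.trans (Pi.zero_apply _)]
    exact Finset.sum_congr rfl fun l _ => (eq_coeffFun_mul_theta (hx l) (z, v.2)).symm
  · refine ⟨fun m v => coeffFun τ m s v.2 * theta δ τ m v,
      fun m => mul_theta_mem (coeffFun_mem hs m) m, funext fun v => ?_⟩
    rw [Finset.sum_apply]
    by_cases hv : v.2 ∈ cover (perM δ τ) W
    · exact (eq_sum_coeffFun (slice_mem_fibre hs hv) v.1).symm
    · simp [hs.2.2 v hv, fun m => (coeffFun_mem hs m).2.2 _ hv]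

theorem isInternal_lineFibre (μ : ℂ) : DirectSum.IsInternal fun m : Fin δ =>
    (lineFibre (theta δ τ m) μ).submoduleOf (fibre (Ktilde δ τ) μ) := by
  refine isInternal_submoduleOf (fun m => ?_) (fun x hx h0 m => ?_) fun f hf => ?_
  · exact (Submodule.span_singleton_le_iff_mem _ _).mpr (theta_slice_mem δ τ m μ)
  · choose c hc using fun l => Submodule.mem_span_singleton.mp (hx l)
    rw [← hc m, theta_linearIndependent (τ := τ) (μ := μ) (c := c) (fun z => ?_) m, zero_smul]
    have := congrFun h0 z
    simp only [← hc, Finset.sum_apply] at this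
    exact this
  -- An element of a single fibre is extended constantly in `μ`, so that `coeffFun` applies to it.
  · refine ⟨fun m z => coeffFun τ m (fun v => f v.1) μ * theta δ τ m (z, μ),
      fun m => Submodule.mem_span_singleton.mpr ⟨_, rfl⟩, funext fun z => ?_⟩
    rw [Finset.sum_apply]
    exact (eq_sum_coeffFun (s := fun v => f v.1) hf z).symm

theorem theta_slice_ne_zero (m : Fin δ) (μ : ℂ) : (fun z => theta δ τ m (z, μ)) ≠ 0 := fun h => by
  have := congrFun h (basePoint δ τ m - μ)
  simp only [theta_eq, sub_add_cancel] at this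
  exact thetaOne_basePoint_ne_zero δ τ m this

theorem finrank_lineFibre (m : Fin δ) (μ : ℂ) :
    Module.finrank ℂ (lineFibre (theta δ τ m) μ) = 1 :=
  finrank_span_singleton (theta_slice_ne_zero m μ)

/-- Needed to force every frame to have `δ` members. -/
theorem finrank_fibre (μ : ℂ) : Module.finrank ℂ (fibre (Ktilde δ τ) μ) = δ := by
  have hli : LinearIndependent ℂ fun m : Fin δ => fun z => theta δ τ m (z, μ) := by
    rw [Fintype.linearIndependent_iff]
    intro c hc
    exact theta_linearIndependent (τ := τ) (μ := μ) fun z => by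
      simpa using congrFun hc z
  have hspan : Submodule.span ℂ (Set.range fun m : Fin δ => fun z => theta δ τ m (z, μ)) =
      fibre (Ktilde δ τ) μ := by
    refine le_antisymm (Submodule.span_le.mpr ?_) fun f hf => ?_
    · rintro _ ⟨m, rfl⟩
      exact theta_slice_mem δ τ m μ
    · refine (Submodule.mem_span_range_iff_exists_fun ℂ).mpr
        ⟨fun m => coeffFun τ m (fun v => f v.1) μ, funext fun z => ?_⟩
      rw [Finset.sum_apply]
      exact (eq_sum_coeffFun (s := fun v => f v.1) hf z).symm
  rw [← hspan, finrank_span_eq_card hli, Fintype.card_fin]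

end

section

open Complex

/-! ### Integrals over the period parallelogram -/

section Parallelogram

open MeasureTheory
open scoped Pointwise

variable {ω₁ ω₂ : ℂ}

/-- The real basis of `ℂ` given by two independent periods. -/
def periodBasis (h : LinearIndependent ℝ ![ω₁, ω₂]) : Module.Basis (Fin 2) ℝ ℂ :=
  basisOfLinearIndependentOfCardEqFinrank h (by simp [Complex.finrank_real_complex])

theorem parallelogram_eq (h : LinearIndependent ℝ ![ω₁, ω₂]) :
    parallelogram ω₁ ω₂ = ZSpan.fundamentalDomain (periodBasis h) := by
  ext z
  rw [ZSpan.mem_fundamentalDomain, Fin.forall_fin_two]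
  constructor
  · rintro ⟨a, ha, b, hb, rfl⟩
    have : (a * ω₁ + b * ω₂ : ℂ) = ∑ i, ![a, b] i • periodBasis h i := by
      simp [periodBasis]
    rw [this, (periodBasis h).repr_sum_self]
    exact ⟨ha, hb⟩
  · rintro ⟨h0, h1⟩
    refine ⟨_, h0, _, h1, ?_⟩
    conv_lhs => rw [← (periodBasis h).sum_repr z]
    simp [periodBasis]

theorem mem_span_periodBasis (h : LinearIndependent ℝ ![ω₁, ω₂]) {x : ℂ}
    (hx : x ∈ Submodule.span ℤ (Set.range (periodBasis h))) : ∃ g, periods ω₁ ω₂ g = x := by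
  obtain ⟨c, hc⟩ := (Submodule.mem_span_range_iff_exists_fun ℤ).mp hx
  refine ⟨(c 0, c 1), ?_⟩
  rw [← hc]
  simp [periods, periodBasis]

/-- A translate of a fundamental domain is again one, and a periodic function has the same integral
over both. -/
theorem setIntegral_parallelogram_add (h : LinearIndependent ℝ ![ω₁, ω₂]) {F : ℂ → ℂ}
    (hF : ∀ g w, F (w + periods ω₁ ω₂ g) = F w) (μ : ℂ) :
    ∫ z in parallelogram ω₁ ω₂, F (z + μ) = ∫ z in parallelogram ω₁ ω₂, F z := by
  have hD := ZSpan.isAddFundamentalDomain' (periodBasis h) (volume : Measure ℂ)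
  have : Countable (Submodule.span ℤ (Set.range (periodBasis h))).toAddSubgroup :=
    inferInstanceAs (Countable (Submodule.span ℤ (Set.range (periodBasis h))))
  have hinv : ∀ (g : (Submodule.span ℤ (Set.range (periodBasis h))).toAddSubgroup) (x : ℂ),
      F (g +ᵥ x) = F x := by
    rintro ⟨g, hg⟩ x
    obtain ⟨g, rfl⟩ := mem_span_periodBasis h hg
    rw [AddSubgroup.mk_vadd, vadd_eq_add, add_comm, hF]
  have h1 := hD.setIntegral_eq (hD.vadd_of_comm μ) hinv
  rw [parallelogram_eq h, h1]
  have h2 := (measurePreserving_add_right volume μ).setIntegral_preimage_emb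
    (measurableEmbedding_addRight μ) F (μ +ᵥ ZSpan.fundamentalDomain (periodBasis h))
  rw [← h2]
  congr 2
  ext z
  simp [Set.mem_vadd_set_iff_neg_vadd_mem]

theorem integrableOn_parallelogram (h : LinearIndependent ℝ ![ω₁, ω₂]) {E : Type*}
    [NormedAddCommGroup E] {F : ℂ → E} (hF : Continuous F) :
    IntegrableOn F (parallelogram ω₁ ω₂) := by
  rw [parallelogram_eq h]
  have hb := ZSpan.fundamentalDomain_isBounded (periodBasis h)
  exact (hF.continuousOn.integrableOn_compact hb.isCompact_closure).mono_set subset_closure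

/-- Were the integral zero, the support would meet the parallelogram in a null set, hence be null by
periodicity; but it is open and nonempty. -/
theorem setIntegral_parallelogram_pos (h : LinearIndependent ℝ ![ω₁, ω₂]) {F : ℂ → ℝ}
    (hF : Continuous F) (hinv : ∀ g w, F (w + periods ω₁ ω₂ g) = F w) (h0 : ∀ w, 0 ≤ F w)
    {w₀ : ℂ} (hw₀ : F w₀ ≠ 0) : 0 < ∫ z in parallelogram ω₁ ω₂, F z := by
  have hD := ZSpan.isAddFundamentalDomain' (periodBasis h) (volume : Measure ℂ)
  have : Countable (Submodule.span ℤ (Set.range (periodBasis h))).toAddSubgroup :=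
    inferInstanceAs (Countable (Submodule.span ℤ (Set.range (periodBasis h))))
  rw [setIntegral_pos_iff_support_of_nonneg_ae (Filter.Eventually.of_forall h0)
    (integrableOn_parallelogram h hF), pos_iff_ne_zero, parallelogram_eq h]
  intro hz
  have h1 := hD.measure_zero_of_invariant (Function.support F) (fun g => by
    obtain ⟨g, hg⟩ := g
    obtain ⟨g, rfl⟩ := mem_span_periodBasis h hg
    ext x
    rw [Set.mem_vadd_set_iff_neg_vadd_mem, Function.mem_support, Function.mem_support,
      ← hinv g (_ +ᵥ x)]
    simp [AddSubgroup.vadd_def]) hz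
  exact (hF.isOpen_support.measure_pos volume ⟨w₀, hw₀⟩).ne' h1

end Parallelogram

/-! ### The Gram matrix -/

section Gram

open MeasureTheory

variable {δ : ℕ} {τ : UpperHalfPlane} [NeZero δ]

variable (δ τ) in
theorem linearIndependent_periods : LinearIndependent ℝ ![(δ : ℂ), (τ : ℂ)] := by
  rw [LinearIndependent.pair_iff]
  intro a b h
  have h1 := congrArg Complex.im h
  have h2 := congrArg Complex.re h
  simp [τ.im_pos.ne'] at h1
  simp [h1, NeZero.ne δ] at h2
  exact ⟨h2, h1⟩

variable (δ τ) in
/-- The `L²` inner product of sections of `L₀`. -/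
def pairing (f g : ℂ → ℂ) : ℂ :=
  ∫ w in parallelogram δ τ, ((hK δ τ).h (w, 0) : ℂ) * f w * (starRingEnd ℂ) (g w)

theorem hK_h_eq (z μ : ℂ) : (hK δ τ).h (z, μ) = (hK δ τ).h (z + μ, 0) := by
  simp [hK]

theorem continuous_hK : Continuous fun w : ℂ => (hK δ τ).h (w, 0) :=
  (hK δ τ).smooth.continuous.comp (by fun_prop)

omit [NeZero δ] in
theorem continuous_of_mem_H0 {f : ℂ → ℂ} (hf : f ∈ (L0 δ τ).H0) : Continuous f :=
  ((mem_H0_L0_iff δ τ).mp hf).1.continuous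

/-- At `μ = 0` the metric on `K̃` restricts to one on `L₀`, whose weight absorbs the squared norm of
the multiplier. -/
theorem pairing_integrand_periodic {f f' : ℂ → ℂ} (hf : f ∈ (L0 δ τ).H0)
    (hf' : f' ∈ (L0 δ τ).H0) (g : ℤ × ℤ) (w : ℂ) :
    ((hK δ τ).h (w + perM δ τ g, 0) : ℂ) * f (w + perM δ τ g) *
      (starRingEnd ℂ) (f' (w + perM δ τ g)) =
    ((hK δ τ).h (w, 0) : ℂ) * f w * (starRingEnd ℂ) (f' w) := by
  have h1 := (hK δ τ).invariant (g, 0) (w, 0)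
  have h2 : (Ktilde δ τ).mult (g, 0) (w, 0) = (L0 δ τ).mult g w := by
    simp [Ktilde_mult]
  have h3 : ((w, 0) + ((perM δ τ).prodMap (perM δ τ)) (g, 0) : ℂ × ℂ) = (w + perM δ τ g, 0) := by
    simp
  rw [h2, h3] at h1
  rw [hf.2.1 g w (Set.mem_univ _), hf'.2.1 g w (Set.mem_univ _), ← h1, map_mul]
  push_cast
  rw [← Complex.mul_conj']
  ring

/-- The `L²` inner product on the fibre at `μ` is that on the sections of `L₀`. -/
theorem l2Inner_eq_pairing {f f' : ℂ → ℂ} (hf : f ∈ (L0 δ τ).H0) (hf' : f' ∈ (L0 δ τ).H0)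
    (μ : ℂ) : l2Inner (ω₁ := δ) (ω₂ := τ) (sliceMetric (hK δ τ) μ) (fun z => f (z + μ))
      (fun z => f' (z + μ)) = pairing δ τ f f' := by
  -- The substitution `w = z + μ` removes `μ` altogether, which is the source of flatness.
  rw [pairing, ← setIntegral_parallelogram_add (linearIndependent_periods δ τ)
    (pairing_integrand_periodic hf hf') μ]
  simp only [← hK_h_eq _ μ]
  rfl

theorem pairing_sum {ι : Type*} [Fintype ι] {e : ι → ℂ → ℂ} (he : ∀ i, e i ∈ (L0 δ τ).H0)
    (a b : ι → ℂ) :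
    pairing δ τ (fun w => ∑ l, a l * e l w) (fun w => ∑ m, b m * e m w) =
      ∑ l, ∑ m, a l * pairing δ τ (e l) (e m) * (starRingEnd ℂ) (b m) := by
  have hc := fun i => continuous_of_mem_H0 (he i)
  have hh := continuous_hK (δ := δ) (τ := τ)
  have hi : ∀ l m, IntegrableOn (fun w : ℂ => a l * (((hK δ τ).h (w, 0) : ℂ) * e l w *
      (starRingEnd ℂ) (e m w)) * (starRingEnd ℂ) (b m)) (parallelogram δ τ) := by
    intro l m
    refine integrableOn_parallelogram (linearIndependent_periods δ τ) ?_
    have := Complex.continuous_ofReal.comp hh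
    exact (continuous_const.mul ((this.mul (hc l)).mul
      (Complex.continuous_conj.comp (hc m)))).mul continuous_const
  simp only [pairing, ← integral_const_mul, ← integral_mul_const]
  simp only [← integral_finsetSum Finset.univ fun m _ => hi _ m]
  rw [← integral_finsetSum Finset.univ fun l _ =>
    integrable_finsetSum Finset.univ fun m _ => hi l m]
  congr 1
  ext w
  rw [map_sum, mul_assoc, Finset.sum_mul_sum, Finset.mul_sum]
  refine Finset.sum_congr rfl fun l _ => ?_
  rw [Finset.mul_sum]
  refine Finset.sum_congr rfl fun m _ => ?_
  rw [map_mul]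
  ring

theorem pairing_self_pos {f : ℂ → ℂ} (hf : f ∈ (L0 δ τ).H0) {w₀ : ℂ} (hw₀ : f w₀ ≠ 0) :
    0 < pairing δ τ f f := by
  have h1 : ∀ w, ((hK δ τ).h (w, 0) : ℂ) * f w * (starRingEnd ℂ) (f w) =
      (((hK δ τ).h (w, 0) * ‖f w‖ ^ 2 : ℝ) : ℂ) := fun w => by
    rw [mul_assoc, Complex.mul_conj']
    push_cast
    rfl
  rw [pairing]
  simp only [h1]
  rw [integral_complex_ofReal, Complex.zero_lt_real]
  refine setIntegral_parallelogram_pos (linearIndependent_periods δ τ)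
    (continuous_hK.mul ((continuous_of_mem_H0 hf).norm.pow 2)) (fun g w => ?_)
    (fun w => mul_nonneg ((hK δ τ).pos _).le (sq_nonneg _)) (w₀ := w₀)
    (mul_ne_zero ((hK δ τ).pos _).ne' (pow_ne_zero _ (norm_ne_zero_iff.mpr hw₀)))
  have := pairing_integrand_periodic hf hf g w
  rw [h1, h1] at this
  exact_mod_cast this

theorem pairing_conj (f g : ℂ → ℂ) : (starRingEnd ℂ) (pairing δ τ f g) = pairing δ τ g f := by
  rw [pairing, pairing, ← integral_conj]
  congr 1
  ext w
  simp only [map_mul, Complex.conj_conj, Complex.conj_ofReal]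
  ring

variable (δ τ) in
/-- The Gram matrix of the theta functions. -/
def thetaGram : Matrix (Fin δ) (Fin δ) ℂ :=
  Matrix.of fun l m => pairing δ τ (thetaOne δ τ l) (thetaOne δ τ m)

theorem thetaGram_posDef : (thetaGram δ τ).PosDef := by
  refine Matrix.PosDef.of_dotProduct_mulVec_pos (Matrix.IsHermitian.ext fun i j => ?_)
    fun x hx => ?_
  · exact pairing_conj _ _
  -- The form `x* G x` conjugates its left vector while `pairing` is linear on the left, hence the
  -- coefficients `star x`.
  · let f : ℂ → ℂ := fun w => ∑ l, star x l * thetaOne δ τ l w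
    have hf : f ∈ (L0 δ τ).H0 := by
      have : f = ∑ l, star x l • thetaOne δ τ l := by
        ext w
        simp [f]
      rw [this]
      exact Submodule.sum_mem _ fun l _ => Submodule.smul_mem _ _ (thetaOne_mem δ τ l)
    have hne : ∃ w, f w ≠ 0 := by
      by_contra! h
      refine hx (funext fun m => star_eq_zero.mp ?_)
      exact theta_linearIndependent (τ := τ) (μ := 0) (c := star x)
        (fun z => by simpa [f, theta_eq] using h z) m
    obtain ⟨w₀, hw₀⟩ := hne
    have h1 := pairing_self_pos hf hw₀
    rw [pairing_sum (thetaOne_mem δ τ)] at h1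
    convert h1 using 1
    simp only [dotProduct, Matrix.mulVec, Finset.mul_sum, thetaGram, Matrix.of_apply,
      Pi.star_apply, mul_assoc, RCLike.star_def, Complex.conj_conj]

variable (τ) in
/-- The matrix of coefficients of sections of the direct image with respect to the `θ_m`. -/
def coeffMatrix {r : ℕ} (s : Fin r → ℂ × ℂ → ℂ) (μ : ℂ) : Matrix (Fin r) (Fin δ) ℂ :=
  Matrix.of fun i m => coeffFun τ m (s i) μ

/-- Change of frame: all dependence on `μ` sits in the holomorphic coefficient matrix. -/
theorem gram_eq {r : ℕ} {s : Fin r → ℂ × ℂ → ℂ} {μ : ℂ}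
    (hs : ∀ i, (fun z => s i (z, μ)) ∈ fibre (Ktilde δ τ) μ) :
    gram (ω₁ := δ) (ω₂ := τ) (hK δ τ) s μ =
      coeffMatrix (δ := δ) τ s μ * thetaGram δ τ *
        (coeffMatrix (δ := δ) τ s μ).conjTranspose := by
  ext i j
  have h1 := l2Inner_eq_pairing (comp_sub_mem_H0 (hs i)) (comp_sub_mem_H0 (hs j)) μ
  simp only [add_sub_cancel_right] at h1
  have h2 : ∀ i, (fun w => s i (w - μ, μ)) =
      fun w => ∑ m, coeffFun τ m (s i) μ * thetaOne δ τ m w := fun i => by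
    ext w
    rw [eq_sum_coeffFun (hs i)]
    simp [theta_eq]
  refine h1.trans ?_
  rw [h2, h2, pairing_sum (thetaOne_mem δ τ), Finset.sum_comm]
  simp only [Matrix.mul_apply, Matrix.conjTranspose_apply, Finset.sum_mul]
  rfl

theorem gram_posDef {r : ℕ} {s : Fin r → ℂ × ℂ → ℂ} {μ : ℂ}
    (hs : ∀ i, (fun z => s i (z, μ)) ∈ fibre (Ktilde δ τ) μ)
    (hli : LinearIndependent ℂ fun i : Fin r => fun z : ℂ => s i (z, μ)) :
    (gram (ω₁ := δ) (ω₂ := τ) (hK δ τ) s μ).PosDef := by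
  rw [gram_eq hs]
  -- What is needed is that the rows of the coefficient matrix are independent; a relation among
  -- them is a relation among the `s i`.
  refine thetaGram_posDef.mul_mul_conjTranspose_same fun v w hvw => ?_
  rw [Fintype.linearIndependent_iff] at hli
  refine sub_eq_zero.mp (funext (hli (v - w) (funext fun z => ?_)))
  have h1 : Matrix.vecMul (v - w) (coeffMatrix (δ := δ) τ s μ) = 0 := by
    rw [Matrix.sub_vecMul]
    exact sub_eq_zero.mpr hvw
  simp only [Finset.sum_apply, Pi.smul_apply, smul_eq_mul, Pi.zero_apply]
  simp only [eq_sum_coeffFun (hs _), Finset.mul_sum]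
  rw [Finset.sum_comm]
  refine Finset.sum_eq_zero fun m _ => ?_
  simp only [← mul_assoc, ← Finset.sum_mul]
  exact mul_eq_zero_of_left (congrFun h1 m) _

end Gram

end

section

open Complex

/-! ### Curvature -/

section Curvature

theorem dWirt_congr {f g : ℂ → ℂ} {μ : ℂ} (h : f =ᶠ[nhds μ] g) : dWirt f μ = dWirt g μ := by
  rw [dWirt, dWirt, h.fderiv_eq]

theorem dbarWirt_congr {f g : ℂ → ℂ} {μ : ℂ} (h : f =ᶠ[nhds μ] g) :
    dbarWirt f μ = dbarWirt g μ := by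
  rw [dbarWirt, dbarWirt, h.fderiv_eq]

theorem dbarWirt_eq_zero {f : ℂ → ℂ} {μ : ℂ} (hf : DifferentiableAt ℂ f μ) :
    dbarWirt f μ = 0 := by
  rw [dbarWirt, (hf.hasDerivAt.hasFDerivAt.restrictScalars ℝ).fderiv]
  simp [← mul_assoc]

/-- The conjugate factor is antiholomorphic, so `∂` treats it as a constant. -/
theorem dWirt_mul_conj {f g : ℂ → ℂ} {μ : ℂ} (hf : DifferentiableAt ℂ f μ)
    (hg : DifferentiableAt ℂ g μ) :
    dWirt (fun w => f w * (starRingEnd ℂ) (g w)) μ = deriv f μ * (starRingEnd ℂ) (g μ) := by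
  have h1 := hf.hasDerivAt.hasFDerivAt.restrictScalars ℝ
  have h2 : HasFDerivAt (fun w => (starRingEnd ℂ) (g w)) _ μ :=
    (Complex.conjCLE.hasFDerivAt (x := g μ)).comp μ
      (hg.hasDerivAt.hasFDerivAt.restrictScalars ℝ)
  have h3 : HasFDerivAt (fun w => f w * (starRingEnd ℂ) (g w)) _ μ := h1.mul h2
  rw [dWirt, h3.fderiv]
  simp
  linear_combination (1 / 2 * (f μ * (starRingEnd ℂ) (deriv g μ) +
    - deriv f μ * (starRingEnd ℂ) (g μ))) * Complex.I_sq

theorem differentiableAt_real_mul_conj {f g : ℂ → ℂ} {μ : ℂ} (hf : DifferentiableAt ℂ f μ)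
    (hg : DifferentiableAt ℂ g μ) :
    DifferentiableAt ℝ (fun w => f w * (starRingEnd ℂ) (g w)) μ :=
  (hf.restrictScalars ℝ).mul
    (Complex.conjCLE.differentiableAt.comp μ (hg.restrictScalars ℝ))

theorem dWirt_sum {ι : Type*} {u : Finset ι} {f : ι → ℂ → ℂ} {μ : ℂ}
    (hf : ∀ i ∈ u, DifferentiableAt ℝ (f i) μ) :
    dWirt (fun w => ∑ i ∈ u, f i w) μ = ∑ i ∈ u, dWirt (f i) μ := by
  simp only [dWirt]
  rw [fderiv_fun_sum hf]
  simp only [_root_.sum_apply]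
  rw [Finset.mul_sum, ← Finset.sum_sub_distrib, Finset.sum_div]

theorem differentiableAt_det {n : Type*} [Fintype n] [DecidableEq n] {A : ℂ → Matrix n n ℂ}
    {μ : ℂ} (hA : ∀ i j, DifferentiableAt ℂ (fun w => A w i j) μ) :
    DifferentiableAt ℂ (fun w => (A w).det) μ := by
  simp only [Matrix.det_apply]
  exact DifferentiableAt.fun_sum fun σ _ =>
    (DifferentiableAt.fun_finsetProd fun i _ => hA _ _).const_smul _

theorem differentiableAt_inv {n : Type*} [Fintype n] [DecidableEq n] {A : ℂ → Matrix n n ℂ}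
    {μ : ℂ} (hA : ∀ i j, DifferentiableAt ℂ (fun w => A w i j) μ) (h0 : (A μ).det ≠ 0) (i j : n) :
    DifferentiableAt ℂ (fun w => (A w)⁻¹ i j) μ := by
  simp only [Matrix.inv_def, Ring.inverse_eq_inv', Matrix.smul_apply, smul_eq_mul,
    Matrix.adjugate_apply]
  refine ((differentiableAt_det hA).inv h0).mul (differentiableAt_det fun k l => ?_)
  simp only [Matrix.updateRow_apply]
  split_ifs
  · exact differentiableAt_const _
  · exact hA k l

variable {n : ℕ} {U : Set ℂ} {H A : ℂ → Matrix (Fin n) (Fin n) ℂ} {G : Matrix (Fin n) (Fin n) ℂ}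

theorem contDiffOn_mul_conjTranspose (hU : IsOpen U)
    (hA : ∀ i j, DifferentiableOn ℂ (fun w => A w i j) U)
    (hH : ∀ w ∈ U, H w = A w * G * (A w).conjTranspose) (i j : Fin n) :
    ContDiffOn ℝ ∞ (fun w => H w i j) U := by
  have hc : ∀ i j, ContDiffOn ℝ ∞ (fun w => A w i j) U := fun i j =>
    ((hA i j).contDiffOn hU).restrict_scalars ℝ
  have h1 : ContDiffOn ℝ ∞
      (fun w => ∑ m, (∑ l, A w i l * G l m) * (starRingEnd ℂ) (A w j m)) U :=
    ContDiffOn.sum fun m _ => (ContDiffOn.sum fun l _ => (hc i l).mul contDiffOn_const).mul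
      (Complex.conjCLE.contDiff.comp_contDiffOn (hc j m))
  refine h1.congr fun w hw => ?_
  rw [hH w hw]
  simp [Matrix.mul_apply]

/-- If the Gram matrix of a frame is `A G A^*` with `A` holomorphic and `G` constant, then the
Chern connection matrix is `∂A · A⁻¹`. -/
theorem chernConnection_eq (hU : IsOpen U)
    (hA : ∀ i j, DifferentiableOn ℂ (fun w => A w i j) U)
    (hH : ∀ w ∈ U, H w = A w * G * (A w).conjTranspose) (hdet : ∀ w ∈ U, (H w).det ≠ 0)
    {μ : ℂ} (hμ : μ ∈ U) :
    chernConnection H μ = (Matrix.of fun i j => deriv (fun w => A w i j) μ) * (A μ)⁻¹ := by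
  have hnhds := hU.mem_nhds hμ
  have hd : ∀ i j, DifferentiableAt ℂ (fun w => A w i j) μ := fun i j =>
    (hA i j).differentiableAt hnhds
  have h1 : (Matrix.of fun i j => dWirt (fun w => H w i j) μ) =
      (Matrix.of fun i j => deriv (fun w => A w i j) μ) * (G * (A μ).conjTranspose) := by
    ext i j
    have h2 : (fun w => H w i j) =ᶠ[nhds μ]
        fun w => ∑ m, (∑ l, A w i l * G l m) * (starRingEnd ℂ) (A w j m) := by
      filter_upwards [hnhds] with w hw
      rw [hH w hw]
      simp [Matrix.mul_apply]
    have h3 : ∀ m, DifferentiableAt ℂ (fun w => ∑ l, A w i l * G l m) μ := fun m =>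
      DifferentiableAt.fun_sum fun l _ => (hd i l).mul_const _
    rw [Matrix.of_apply, dWirt_congr h2,
      dWirt_sum fun m _ => differentiableAt_real_mul_conj (h3 m) (hd j m), ← Matrix.mul_assoc,
      Matrix.mul_apply]
    refine Finset.sum_congr rfl fun m _ => ?_
    rw [dWirt_mul_conj (h3 m) (hd j m), deriv_fun_sum fun l _ => (hd i l).mul_const _,
      Matrix.mul_apply]
    simp only [deriv_mul_const (hd i _)]
    rfl
  -- Both `∂H` and `H` carry the right factor `G A*`, which is invertible because `det H ≠ 0`, so it
  -- cancels.
  have h4 := hdet μ hμ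
  have h5 := hH μ hμ
  rw [Matrix.mul_assoc] at h5
  rw [h5, Matrix.det_mul] at h4
  rw [chernConnection, h1, h5, Matrix.mul_inv_rev, Matrix.mul_assoc, ← Matrix.mul_assoc _ _ (A μ)⁻¹,
    Matrix.mul_nonsing_inv _ (isUnit_iff_ne_zero.mpr (right_ne_zero_of_mul h4)), Matrix.one_mul]

/-- The connection matrix equals `∂A · A⁻¹` on all of `U`, and this is holomorphic. -/
theorem chernCurvature_eq_zero (hU : IsOpen U)
    (hA : ∀ i j, DifferentiableOn ℂ (fun w => A w i j) U)
    (hH : ∀ w ∈ U, H w = A w * G * (A w).conjTranspose) (hdet : ∀ w ∈ U, (H w).det ≠ 0)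
    {μ : ℂ} (hμ : μ ∈ U) : chernCurvature H μ = 0 := by
  have hnhds := hU.mem_nhds hμ
  have hdetA : (A μ).det ≠ 0 := by
    have := hdet μ hμ
    rw [hH μ hμ, Matrix.mul_assoc, Matrix.det_mul] at this
    exact left_ne_zero_of_mul this
  ext i j
  have h1 : (fun w => chernConnection H w i j) =ᶠ[nhds μ]
      fun w => ∑ k, deriv (fun w => A w i k) w * (A w)⁻¹ k j := by
    filter_upwards [hnhds] with w hw
    rw [chernConnection_eq hU hA hH hdet hw, Matrix.mul_apply]
    rfl
  rw [chernCurvature, Matrix.of_apply, dbarWirt_congr h1, Matrix.zero_apply]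
  refine dbarWirt_eq_zero (DifferentiableAt.fun_sum fun k _ => ?_)
  exact (((hA i k).deriv hU).differentiableAt hnhds).mul
    (differentiableAt_inv (fun i j => (hA i j).differentiableAt hnhds) hdetA k j)

end Curvature

end

/-! ### Smoothness, positivity and flatness in an arbitrary holomorphic frame -/

section

theorem isOpen_cover {G V : Type*} [AddCommGroup G] [NormedAddCommGroup V] {p : G →+ V}
    {W : Set (Torus p)} (hW : IsOpen W) : IsOpen (cover p W) :=
  hW.preimage continuous_quotient_mk'

/-- The `L²` metric is a smooth Hermitian metric on the direct image, and it is flat. -/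
theorem gram_smooth_posDef_flat {δ : ℕ} {τ : UpperHalfPlane} [NeZero δ]
    {W : Set (Torus (perM δ τ))} (hW : IsOpen W) {r : ℕ} {s : Fin r → ℂ × ℂ → ℂ}
    (hs : IsHolFrame (Ktilde δ τ) W s) :
    (∀ i j, ContDiffOn ℝ ∞ (fun μ => gram (ω₁ := δ) (ω₂ := τ) (hK δ τ) s μ i j)
      (cover (perM δ τ) W)) ∧
    ∀ μ ∈ cover (perM δ τ) W, (gram (ω₁ := δ) (ω₂ := τ) (hK δ τ) s μ).PosDef ∧
      chernCurvature (gram (ω₁ := δ) (ω₂ := τ) (hK δ τ) s) μ = 0 := by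
  have hU := isOpen_cover hW
  have hfib : ∀ μ ∈ cover (perM δ τ) W, ∀ i, (fun z => s i (z, μ)) ∈ fibre (Ktilde δ τ) μ :=
    fun μ hμ i => slice_mem_fibre (hs.1 i) hμ
  -- Over the empty set `r` is unconstrained and the claim is vacuous; otherwise one fibre gives `r
  -- = δ`, so the coefficient matrix is square.
  rcases (cover (perM δ τ) W).eq_empty_or_nonempty with he | ⟨μ₀, hμ₀⟩
  · rw [he]
    exact ⟨fun i j => contDiffOn_empty, fun μ hμ => hμ.elim⟩
  have hr : r = δ := by
    have h1 := finrank_span_eq_card (hs.2 μ₀ hμ₀).1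
    rw [(hs.2 μ₀ hμ₀).2, finrank_fibre, Fintype.card_fin] at h1
    exact h1.symm
  subst hr
  have hA : ∀ i j, DifferentiableOn ℂ (fun μ => coeffMatrix τ s μ i j) (cover (perM r τ) W) :=
    fun i j => differentiableOn_coeffFun (hs.1 i) j
  have hH := fun μ hμ => gram_eq (hfib μ hμ)
  have hpos := fun μ hμ => gram_posDef (hfib μ hμ) (hs.2 μ hμ).1
  refine ⟨contDiffOn_mul_conjTranspose hU hA hH, fun μ hμ => ⟨hpos μ hμ, ?_⟩⟩
  exact chernCurvature_eq_zero hU hA hH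
    (fun w hw => ((Matrix.isUnit_iff_isUnit_det _).mp (hpos w hw).isUnit).ne_zero) hμ

end

end ThetaBundle

end

open ThetaBundle in
theorem mainTheorem4 (δ : ℕ) [NeZero δ] (τ : UpperHalfPlane) :
    -- the `L²` metric is a Hermitian metric on `K`, and its curvature vanishes
    (∀ (W : Set (Torus (perM δ τ))), IsOpen W →
      ∀ (r : ℕ) (s : Fin r → ℂ × ℂ → ℂ), IsHolFrame (Ktilde δ τ) W s →
        (∀ i j, ContDiffOn ℝ ∞ (fun μ => gram (hK δ τ) s μ i j) (cover (perM δ τ) W)) ∧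
        ∀ μ ∈ cover (perM δ τ) W,
          (gram (hK δ τ) s μ).PosDef ∧ chernCurvature (gram (hK δ τ) s) μ = 0) ∧
    -- each `θ_m` is a global section of `K`
    (∀ m : Fin δ, theta δ τ m ∈ directImage (Ktilde δ τ) Set.univ) ∧
    -- every fibre of `K` is the direct sum of the lines spanned by the `θ_m`
    (∀ μ : ℂ, (∀ m : Fin δ, lineFibre (theta δ τ m) μ ≤ fibre (Ktilde δ τ) μ ∧
        Module.finrank ℂ (lineFibre (theta δ τ m) μ) = 1) ∧
      DirectSum.IsInternal fun m : Fin δ =>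
        (lineFibre (theta δ τ m) μ).submoduleOf (fibre (Ktilde δ τ) μ)) ∧
    -- the splitting of `K` is holomorphic, and each summand is trivialized by `θ_m`
    (∀ (W : Set (Torus (perM δ τ))), IsOpen W →
      (DirectSum.IsInternal fun m : Fin δ =>
        (lineSections (Ktilde δ τ) (theta δ τ m) W).submoduleOf (directImage (Ktilde δ τ) W)) ∧
      ∀ m : Fin δ, Set.BijOn
        (fun (f : ℂ → ℂ) (v : ℂ × ℂ) => f v.2 * theta δ τ m v)
        (holFunctions (perM δ τ) W : Set (ℂ → ℂ))
        (lineSections (Ktilde δ τ) (theta δ τ m) W : Set (ℂ × ℂ → ℂ))) := by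
  exact ⟨fun W hW r s hs => gram_smooth_posDef_flat hW hs, theta_mem,
    fun μ => ⟨fun m => ⟨(Submodule.span_singleton_le_iff_mem _ _).mpr (theta_slice_mem δ τ m μ),
      finrank_lineFibre m μ⟩, isInternal_lineFibre μ⟩,
    fun W _ => ⟨isInternal_lineSections W, bijOn_mul_theta W⟩⟩
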